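/- **Diagram and lines.** Let $(c_1,\dots,c_k)$ be a sequence of positive integers, and let $\mathscr D$ be the diagram with columns $C_1,\dots,C_k$ from left to right, where the column $C_j$ consists of $c_j$ boxes in the rows $1,\dots,c_j$, rows being numbered from the top. Let $R_i$ be the set of boxes in row $i$ and $R^i=R_1\cup\dots\cup R_i$. For boxes (or columns) write $b<b'$ (resp. $b\le b'$) if the column of $b$ lies strictly to the left of that of $b'$ (resp. does so or equals it). A line joins two boxes $b<b'$ and is directed from left to right; it carries a label $1$ or $*$, and a line carrying $*$ may be gated. A line lies in $R^i$ if both its ends do. A composite line is a concatenation of lines directed from left to right, viewed as the sequence of boxes through which it passes; a single box also counts as a composite line. Composite lines are disjoint if they have no box in common. **Stage $0$.** Any two boxes of a row with no box of that row strictly between them are joined by a horizontal line. The line ending at a box $b'$ carries $*$ if $b'$ is the lowest box of its column and there is a column of the same height further to the left; otherwise it carries $1$. No line is gated. **Stage $i$ ($i\ge1$).** Let $\ell_1,\dots,\ell_u$ be the ungated lines in $R^{i-1}$ carrying $*$, where $\ell_j$ joins $b_j$ to $b_j'$ and $b_1<b_1'\le b_2<b_2'\le\dots\le b_u<b_u'$.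 If $u=0$ nothing is changed. Otherwise gate all of them. Let $\mathscr C$ be the set of columns of height $\ge i$. If $\mathscr C\neq\emptyset$, list as $(C_1,C_2),(C_3,C_4),\dots,(C_{2n-1},C_{2n})$, from left to right, the pairs of consecutive columns of $\mathscr C$ having some $\ell_j$ between them; here and below the $C_j$ denote this relabelling. Let $C_0$ and $C_{2n+1}$ be the leftmost and the rightmost column of $\mathscr C$, and let $b_j''$ be the box of $C_j$ in row $i$. Delete the lines joining $b_j''$ to $b_{j+1}''$, $j$ odd, $1\le j\le 2n-1$. Then draw the following new lines. * For $j\in[0,2n]$ even, let $u_j$ be maximal such that $b_{u_j}<b_j''$ (for $j=0$ only if such an index exists), and join $b_{u_j}$ to $b_j''$. * For $j\in[1,2n+1]$ odd, let $u_j'$ be minimal such that $b_j''<b'_{u_j'}$ (for $j=2n+1$ only if such an index exists), and join $b_j''$ to $b'_{u_j'}$. * For $1\le j<u$, join $b_j$ to $b_{j+1}'$ unless $j$ is one of the $u_m$, $m$ even. If $\mathscr C=\emptyset$, only the last rule is used. For $j$ even, $j\ge 2$, the new line from $b_{u_j}$ to $b_j''$ carries the label of the deleted line from $b_{j-1}''$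 to $b_j''$; all the other new lines carry $1$. **Proposition.** Let $i\ge1$ and consider all the lines present after the $i$-th stage has been carried out. 1. ($P_1^i$) Let $C\le C'$ be columns of height $\ge i$. There is exactly one family of $i$ pairwise disjoint composite lines, formed from these lines (gated or not) and passing only through columns from $C$ to $C'$, such that all the boxes of $R^i$ in the columns from $C$ to $C'$ lie on them. In particular, if the first and the last column of $\mathscr D$ have height $\ge i$, then there is a unique disjoint union of $i$ composite lines on which all the boxes in $R^i$ lie. Moreover, for an arbitrary $\mathscr D$ having at least one column of height $\ge i$, there is exactly one family of $i$ pairwise disjoint composite lines not using gated lines on which all the boxes of $R^i$ lie. 2. The ungated lines in $R^i$ carrying $*$, which are those to be gated at the $(i+1)$-th stage, satisfy: * (up-going linkage to $R_i$) the right end of each of them is in $R_i$; * (strict non-overlapping) they can be listed as lines joining $b_j$ to $b_j'$, $j=1,\dots,v$, with $b_1<b_1'\le b_2<b_2'\le\dots\le b_v<b_v'$; * (adjacency) no column of height $\ge i+1$ lies strictly between the two ends of any of them. -/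

import Mathlib

/-!  Diagrams, the three-step labelling of lines, and the stages of the maximal gating.

A diagram has `k` columns, listed from left to right and indexed by `Fin k`; the column `j` has
height `c j`.  Rows are numbered from the top, starting with `1`.  -/

namespace MaximalGating

variable {k : ℕ}

/-- A position (column, row); it is a box of the diagram when `IsBox` holds. -/
@[ext] structure Box (k : ℕ) where
  col : Fin k
  row : ℕ

/-- The line joining `left` to `right`, directed from left to right. -/
@[ext] structure Line (k : ℕ) where
  left : Box k
  right : Box k

/-- `b` is a box of the diagram with column heights `c`. -/
def IsBox (c : Fin k → ℕ) (b : Box k) : Prop :=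
  1 ≤ b.row ∧ b.row ≤ c b.col

/-- The line lies in the union of the rows `1, …, i`. -/
def Line.InRows (l : Line k) (i : ℕ) : Prop :=
  l.left.row ≤ i ∧ l.right.row ≤ i

/-- Columns `C`, `C'` (in this order) of the same height, with no column of that height
between them. -/
def Neighbouring (c : Fin k → ℕ) (C C' : Fin k) : Prop :=
  C < C' ∧ c C = c C' ∧ ∀ D, C < D → D < C' → c D ≠ c C'

/-- The horizontal lines joining two boxes of a row with no box of that row between them. -/
def JoinsAdjacent (c : Fin k → ℕ) (l : Line k) : Prop :=
  IsBox c l.left ∧ IsBox c l.right ∧ l.left.row = l.right.row ∧ l.left.col < l.right.col ∧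
    ∀ D, l.left.col < D → D < l.right.col → c D < l.left.row

/-- The rightmost labelling: the horizontal lines that carry `*` are those which end at the lowest
box of a column having a left neighbour. -/
def CarriesStar (c : Fin k → ℕ) (l : Line k) : Prop :=
  JoinsAdjacent c l ∧ l.right.row = c l.right.col ∧ ∃ C, Neighbouring c C l.right.col

/-- A collection of labelled lines: those carrying `1`, those carrying `*` which have not been
gated, and those carrying `*` which have been gated. -/
@[ext] structure Labelling (k : ℕ) where
  one : Set (Line k)
  ungated : Set (Line k)
  gated : Set (Line k)

/-- All the lines of a labelling. -/
def Labelling.lines (S : Labelling k) : Set (Line k) :=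
  S.one ∪ S.ungated ∪ S.gated

/-- Stage `0`: all horizontal lines between adjacent boxes, with the rightmost labelling. -/
def initial (c : Fin k → ℕ) : Labelling k where
  one := {l | JoinsAdjacent c l ∧ ¬ CarriesStar c l}
  ungated := {l | CarriesStar c l}
  gated := ∅

/-- The ungated lines lying in the first `i` rows. -/
def Labelling.ungatedIn (S : Labelling k) (i : ℕ) : Set (Line k) :=
  {l | l ∈ S.ungated ∧ l.InRows i}

/-! ### One stage

Below `i` is the number of the stage and `U` the set of the ungated lines
`(b₁, b₁'), …, (b_u, b_u')` in the first `i - 1` rows; these satisfy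
`b₁ < b₁' ≤ b₂ < b₂' ≤ ⋯ ≤ b_u < b_u'` where `<`, `≤` compare columns, so that the
index `j` of a line of `U` may be compared through the column of `b_j`, or of `b_j'`. -/

/-- `C` and `C'` are consecutive among the columns of height at least `i`. -/
def Consecutive (c : Fin k → ℕ) (i : ℕ) (C C' : Fin k) : Prop :=
  i ≤ c C ∧ i ≤ c C' ∧ C < C' ∧ ∀ D, C < D → D < C' → c D < i

/-- The pairs `(C_j, C_{j+1})` with `j` odd of the labelling `C₀, C₁, …, C_{2n+1}` of columns:
consecutive columns of height at least `i` with at least one line of `U` between them. -/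
def IsCut (c : Fin k → ℕ) (i : ℕ) (U : Set (Line k)) (C C' : Fin k) : Prop :=
  Consecutive c i C C' ∧ ∃ l ∈ U, C ≤ l.left.col ∧ l.right.col ≤ C'

/-- `C` is `C_j` for some even `j`: either it is the leftmost column `C₀` of height at least `i`,
or it ends a pair `(C_{j-1}, C_j)` as above. -/
def EvenLabelled (c : Fin k → ℕ) (i : ℕ) (U : Set (Line k)) (C : Fin k) : Prop :=
  (i ≤ c C ∧ ∀ D, i ≤ c D → C ≤ D) ∨ ∃ B, IsCut c i U B C

/-- `C` is `C_j` for some odd `j`: either it is the rightmost column `C_{2n+1}` of height at least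
`i`, or it begins a pair `(C_j, C_{j+1})` as above. -/
def OddLabelled (c : Fin k → ℕ) (i : ℕ) (U : Set (Line k)) (C : Fin k) : Prop :=
  (i ≤ c C ∧ ∀ D, i ≤ c D → D ≤ C) ∨ ∃ B, IsCut c i U C B

/-- `l` is the last line of `U` whose left end lies strictly to the left of the column `C`. -/
def IsLastBefore (U : Set (Line k)) (C : Fin k) (l : Line k) : Prop :=
  l ∈ U ∧ l.left.col < C ∧ ∀ m ∈ U, m.left.col < C → m.left.col ≤ l.left.col

/-- `l` is the first line of `U` whose right end lies strictly to the right of the column `C`. -/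
def IsFirstAfter (U : Set (Line k)) (C : Fin k) (l : Line k) : Prop :=
  l ∈ U ∧ C < l.right.col ∧ ∀ m ∈ U, C < m.right.col → l.right.col ≤ m.right.col

/-- `m` is the line of `U` which follows `l`. -/
def IsNext (U : Set (Line k)) (l m : Line k) : Prop :=
  l ∈ U ∧ m ∈ U ∧ l.left.col < m.left.col ∧
    ∀ n ∈ U, ¬ (l.left.col < n.left.col ∧ n.left.col < m.left.col)

/-- The deleted lines of row `i`, which join the boxes of row `i` in `C_j`, `C_{j+1}`, `j` odd. -/
def deletedLines (c : Fin k → ℕ) (i : ℕ) (U : Set (Line k)) : Set (Line k) :=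
  {x | ∃ C C', IsCut c i U C C' ∧ x = ⟨⟨C, i⟩, ⟨C', i⟩⟩}

/-- New lines ending at the box of row `i` in `C_j`, `j` even; for `C₀` there may be none. -/
def newEven (c : Fin k → ℕ) (i : ℕ) (U : Set (Line k)) : Set (Line k) :=
  {x | ∃ C l, EvenLabelled c i U C ∧ IsLastBefore U C l ∧ x = ⟨l.left, ⟨C, i⟩⟩}

/-- New lines starting at the box of row `i` in `C_j`, `j` odd; for `C_{2n+1}` there may be none. -/
def newOdd (c : Fin k → ℕ) (i : ℕ) (U : Set (Line k)) : Set (Line k) :=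
  {x | ∃ C l, OddLabelled c i U C ∧ IsFirstAfter U C l ∧ x = ⟨⟨C, i⟩, l.right⟩}

/-- New lines gathering the loose ends: `b_j` is joined to `b_{j+1}'` unless `b_j` has already been
joined to the box of row `i` in an even labelled column. -/
def newLoose (c : Fin k → ℕ) (i : ℕ) (U : Set (Line k)) : Set (Line k) :=
  {x | ∃ l m, IsNext U l m ∧ (¬ ∃ C, EvenLabelled c i U C ∧ IsLastBefore U C l) ∧
    x = ⟨l.left, m.right⟩}

/-- The new lines carrying `*`: the line which ends at the box of row `i` in `C_{j+1}`, `j` odd,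
carries `*` when the deleted line ending there does. -/
def newStar (c : Fin k → ℕ) (i : ℕ) (S : Labelling k) (U : Set (Line k)) : Set (Line k) :=
  {x | ∃ B C l, IsCut c i U B C ∧ (⟨⟨B, i⟩, ⟨C, i⟩⟩ : Line k) ∈ S.ungated ∧
    IsLastBefore U C l ∧ x = ⟨l.left, ⟨C, i⟩⟩}

/-- The `i`-th stage, `i ≥ 1`: all the ungated lines in the first `i - 1` rows are gated, some lines
of row `i` are deleted and new lines are drawn. -/
def step (c : Fin k → ℕ) (i : ℕ) (S : Labelling k) : Labelling k :=
  let U := S.ungatedIn (i - 1)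
  { one := (S.one \ deletedLines c i U) ∪
      ((newEven c i U ∪ newOdd c i U ∪ newLoose c i U) \ newStar c i S U)
    ungated := (S.ungated \ (U ∪ deletedLines c i U)) ∪ newStar c i S U
    gated := S.gated ∪ U }

/-- The labelled lines after the `i`-th stage has been carried out. -/
def stage (c : Fin k → ℕ) : ℕ → Labelling k
  | 0 => initial c
  | i + 1 => step c (i + 1) (stage c i)

/-! ### Composite lines -/

/-- A composite line formed from the lines in `L`, given by the boxes through which it passes, from
left to right.  A single box counts as a composite line. -/
def IsCompositeLine (c : Fin k → ℕ) (L : Set (Line k)) (p : List (Box k)) : Prop :=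
  p ≠ [] ∧ (∀ b ∈ p, IsBox c b) ∧ p.IsChain (fun a b => (⟨a, b⟩ : Line k) ∈ L)

/-- `P` is a disjoint union of `i` composite lines formed from the lines in `L`, on which all the
boxes in the first `i` rows of the columns in `X` lie; the composite lines meet only columns
in `X`. -/
structure IsDisjointUnion (c : Fin k → ℕ) (L : Set (Line k)) (i : ℕ) (X : Set (Fin k))
    (P : Finset (List (Box k))) : Prop where
  card_eq : P.card = i
  composite : ∀ p ∈ P, IsCompositeLine c L p
  disjoint : ∀ p ∈ P, ∀ q ∈ P, p ≠ q → p.Disjoint q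
  within : ∀ p ∈ P, ∀ b ∈ p, b.col ∈ X
  covers : ∀ b, IsBox c b → b.row ≤ i → b.col ∈ X → ∃ p ∈ P, b ∈ p

/-! ### Properties of the ungated lines in the first `i` rows -/

/-- Up-going linkage: the ungated lines in the first `i` rows end in row `i`. -/
def UpGoingLinkage (S : Labelling k) (i : ℕ) : Prop :=
  ∀ l ∈ S.ungatedIn i, l.right.row = i

/-- Strict non-overlapping: the ungated lines in the first `i` rows can be listed as
`(b₁, b₁'), …, (b_u, b_u')` with `b₁ < b₁' ≤ b₂ < b₂' ≤ ⋯ ≤ b_u < b_u'`, columns being compared. -/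
def StrictNonOverlapping (S : Labelling k) (i : ℕ) : Prop :=
  ∃ (u : ℕ) (l : Fin u → Line k), Set.range l = S.ungatedIn i ∧
    (∀ j, (l j).left.col < (l j).right.col) ∧
    ∀ j j', j < j' → (l j).right.col ≤ (l j').left.col

/-- Adjacency: no column of height at least `i + 1` lies strictly between the two ends of an ungated
line in the first `i` rows. -/
def Adjacency (c : Fin k → ℕ) (S : Labelling k) (i : ℕ) : Prop :=
  ∀ l ∈ S.ungatedIn i, ∀ D, l.left.col < D → D < l.right.col → c D < i + 1

end MaximalGating

namespace MaximalGating

variable {k : ℕ}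

/-! Call a line active if it has not been gated. The stages preserve an invariant, `Regular`, whose
core is that at most one active line leaves each box and at most one enters it: a stage frees the
ends of the lines it gates or deletes, and the new lines rematch some of these. The active lines
thus form disjoint chains.

Existence and uniqueness for active lines come from counting chains. Columns increase along a line,
so a chain meets a column at most once and a column of height at least `i` forces at least `i`
chains. A chain begins at a box with no incoming active line; the invariant confines such boxes to
the two kinds of `IsStart`, and `isStart_ext` injects them into `1, …, i`. Hence there are exactly
`i` chains, and a family of `i` active paths must use every active line in the first `i` rows.

Between columns `C` and `C'` of height at least `i`, the restricted active chains still form such a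
family. When gated lines are allowed, uniqueness is a weight argument. In any family, succession is
a bijection from the boxes left of `C'` onto the boxes right of `C`. Where a gated and an active
line end at the same box, the active one begins further left, or lower in the same column
(`gated_lt`). The total weight of the predecessors is the same for all bijections, so no gated line
can occur (`rel_of_weight_le`).

The properties of the lines about to be gated are collected in `LinkedUp`: they end at lowest boxes
of columns of height exactly `i`, one at most for each, and pass over no column as high as that.
This orders them strictly. -/

theorem exists_last {p : Fin k → Prop} (h : ∃ x, p x) : ∃ x, p x ∧ ∀ y, p y → y ≤ x := by
  classical
  obtain ⟨a, ha⟩ := h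
  obtain ⟨x, hx, hmax⟩ := Finset.exists_max_image (Finset.univ.filter p) id ⟨a, by simpa using ha⟩
  exact ⟨x, by simpa using hx, fun y hy => hmax y (by simpa using hy)⟩

theorem exists_first {p : Fin k → Prop} (h : ∃ x, p x) : ∃ x, p x ∧ ∀ y, p y → x ≤ y := by
  classical
  obtain ⟨a, ha⟩ := h
  obtain ⟨x, hx, hmin⟩ := Finset.exists_min_image (Finset.univ.filter p) id ⟨a, by simpa using ha⟩
  exact ⟨x, by simpa using hx, fun y hy => hmin y (by simpa using hy)⟩

theorem exists_last_line {U : Set (Line k)} (f : Line k → Fin k) {p : Line k → Prop}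
    (h : ∃ l ∈ U, p l) : ∃ l ∈ U, p l ∧ ∀ m ∈ U, p m → f m ≤ f l := by
  obtain ⟨l, hl, hpl⟩ := h
  obtain ⟨x, ⟨m, hm, hpm, rfl⟩, hx⟩ :=
    exists_last (p := fun x => ∃ l ∈ U, p l ∧ f l = x) ⟨_, l, hl, hpl, rfl⟩
  exact ⟨m, hm, hpm, fun n hn hpn => hx _ ⟨n, hn, hpn, rfl⟩⟩

/-- A set of lines which link up to the lowest boxes of columns of height `i`, at most one to each
such column, without passing over a column of height at least `i`. -/
structure LinkedUp (c : Fin k → ℕ) (i : ℕ) (U : Set (Line k)) : Prop where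
  left_box : ∀ x ∈ U, IsBox c x.left
  left_row : ∀ x ∈ U, x.left.row ≤ i
  right_row : ∀ x ∈ U, x.right.row = i
  height : ∀ x ∈ U, c x.right.col = i
  col_lt : ∀ x ∈ U, x.left.col < x.right.col
  adj : ∀ x ∈ U, ∀ D, x.left.col < D → D < x.right.col → c D < i
  ext : ∀ x ∈ U, ∀ y ∈ U, x.right.col = y.right.col → x = y

/-! ### The order of the lines about to be gated -/

namespace LinkedUp

variable {c : Fin k → ℕ} {i : ℕ} {U : Set (Line k)} (hU : LinkedUp c i U)
include hU

/-- Otherwise the end column of `x`, of height exactly `i`, would lie strictly inside `y`. -/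
theorem right_le_left {x y : Line k} (hx : x ∈ U) (hy : y ∈ U) (h : x.right.col < y.right.col) :
    x.right.col ≤ y.left.col := by
  by_contra! hlt
  have := hU.adj y hy _ hlt h
  have := hU.height x hx
  omega

theorem right_le_left_of_left_lt {x y : Line k} (hx : x ∈ U) (hy : y ∈ U)
    (h : x.left.col < y.left.col) : x.right.col ≤ y.left.col := by
  rcases lt_trichotomy x.right.col y.right.col with h' | h' | h'
  · exact hU.right_le_left hx hy h'
  · rw [hU.ext x hx y hy h'] at h
    exact absurd h (lt_irrefl _)
  · have h1 := hU.right_le_left hy hx h'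
    have h2 := hU.col_lt y hy
    exact absurd (h2.trans_le h1) (by simpa using h.le)

/-- `IsLastBefore` compares left ends and `IsFirstAfter` right ends; both thereby refer to one
enumeration of `U`. -/
theorem left_lt_iff {x y : Line k} (hx : x ∈ U) (hy : y ∈ U) :
    x.left.col < y.left.col ↔ x.right.col < y.right.col :=
  ⟨fun h => (hU.right_le_left_of_left_lt hx hy h).trans_lt (hU.col_lt y hy),
    fun h => (hU.col_lt x hx).trans_le (hU.right_le_left hx hy h)⟩

theorem ext_left {x y : Line k} (hx : x ∈ U) (hy : y ∈ U) (h : x.left.col = y.left.col) :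
    x = y := by
  rcases lt_trichotomy x.right.col y.right.col with h' | h' | h'
  · exact absurd ((hU.left_lt_iff hx hy).2 h') (by simp [h])
  · exact hU.ext x hx y hy h'
  · exact absurd ((hU.left_lt_iff hy hx).2 h') (by simp [h])

/-- A column of height greater than `i` left of the right end of a line is left of the line. -/
theorem le_left {x : Line k} (hx : x ∈ U) {D : Fin k} (hD : i < c D) (h : D < x.right.col) :
    D ≤ x.left.col := by
  by_contra! hlt
  have := hU.adj x hx D hlt h
  omega

theorem right_le {x : Line k} (hx : x ∈ U) {D : Fin k} (hD : i < c D) (h : x.left.col < D) :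
    x.right.col ≤ D := by
  by_contra! hlt
  have := hU.adj x hx D h hlt
  omega

theorem isLastBefore_unique {C : Fin k} {x y : Line k} (hx : IsLastBefore U C x)
    (hy : IsLastBefore U C y) : x = y :=
  hU.ext_left hx.1 hy.1 (le_antisymm (hy.2.2 _ hx.1 hx.2.1) (hx.2.2 _ hy.1 hy.2.1))

theorem isFirstAfter_unique {C : Fin k} {x y : Line k} (hx : IsFirstAfter U C x)
    (hy : IsFirstAfter U C y) : x = y :=
  hU.ext x hx.1 y hy.1 (le_antisymm (hx.2.2 _ hy.1 hy.2.1) (hy.2.2 _ hx.1 hx.2.1))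

theorem isNext_unique_left {x y m : Line k} (hx : IsNext U x m) (hy : IsNext U y m) : x = y := by
  refine hU.ext_left hx.1 hy.1 (le_antisymm ?_ ?_)
  · by_contra! h
    exact hy.2.2.2 x hx.1 ⟨h, hx.2.2.1⟩
  · by_contra! h
    exact hx.2.2.2 y hy.1 ⟨h, hy.2.2.1⟩

theorem isNext_unique_right {x m n : Line k} (hm : IsNext U x m) (hn : IsNext U x n) : m = n := by
  refine hU.ext_left hm.2.1 hn.2.1 (le_antisymm ?_ ?_)
  · by_contra! h
    exact hm.2.2.2 n hn.2.1 ⟨hn.2.2.1, h⟩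
  · by_contra! h
    exact hn.2.2.2 m hm.2.1 ⟨hm.2.2.1, h⟩

omit hU in
theorem exists_isLastBefore {C : Fin k} (h : ∃ l ∈ U, l.left.col < C) :
    ∃ l, IsLastBefore U C l := by
  obtain ⟨l, hl, hlC, hmax⟩ := exists_last_line (fun l => l.left.col) h
  exact ⟨l, hl, hlC, hmax⟩

omit hU in
theorem exists_isNext {m : Line k} (hm : m ∈ U) (h : ∃ l ∈ U, l.left.col < m.left.col) :
    ∃ l, IsNext U l m := by
  obtain ⟨l, hl, hlm, hmax⟩ := exists_last_line (fun l => l.left.col) h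
  exact ⟨l, hl, hm, hlm, fun n hn hn' => absurd (hmax n hn hn'.2) (by simpa using hn'.1)⟩

omit hU in
-- The bound by `B` keeps the line replacing a deleted one inside the cut. Uniqueness of even
-- columns and the adjacency of new starred lines rest on it.
theorem exists_isLastBefore_of_isCut {B C : Fin k} {s : ℕ} (h : IsCut c s U B C)
    (hU : ∀ x ∈ U, x.left.col < x.right.col) :
    ∃ l, IsLastBefore U C l ∧ B ≤ l.left.col := by
  obtain ⟨hcons, l₀, hl₀, hB, hC⟩ := h
  have hlt : l₀.left.col < C := (hU l₀ hl₀).trans_le hC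
  obtain ⟨l, hl⟩ := exists_isLastBefore (C := C) ⟨l₀, hl₀, hlt⟩
  exact ⟨l, hl, hB.trans (hl.2.2 l₀ hl₀ hlt)⟩

end LinkedUp

theorem Consecutive.left_unique {c : Fin k → ℕ} {i : ℕ} {B B' C : Fin k}
    (h : Consecutive c i B C) (h' : Consecutive c i B' C) : B = B' := by
  refine le_antisymm ?_ ?_
  · by_contra! hlt
    have := h'.2.2.2 B hlt h.2.2.1
    have := h.1
    omega
  · by_contra! hlt
    have := h.2.2.2 B' hlt h'.2.2.1
    have := h'.1
    omega

theorem Consecutive.right_unique {c : Fin k → ℕ} {i : ℕ} {B C C' : Fin k}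
    (h : Consecutive c i B C) (h' : Consecutive c i B C') : C = C' := by
  refine le_antisymm ?_ ?_
  · by_contra! hlt
    have := h.2.2.2 C' h'.2.2.1 hlt
    have := h'.2.1
    omega
  · by_contra! hlt
    have := h'.2.2.2 C h.2.2.1 hlt
    have := h.2.1
    omega

theorem exists_consecutive_left {c : Fin k → ℕ} {i : ℕ} {C : Fin k} (hC : i ≤ c C)
    (h : ∃ B, B < C ∧ i ≤ c B) : ∃ B, Consecutive c i B C := by
  obtain ⟨B, ⟨hBC, hB⟩, hmax⟩ := exists_last h
  refine ⟨B, hB, hC, hBC, fun D hD hDC => ?_⟩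
  by_contra! hge
  exact absurd (hmax D ⟨hDC, hge⟩) (by simpa using hD)

theorem exists_consecutive_right {c : Fin k → ℕ} {i : ℕ} {B : Fin k} (hB : i ≤ c B)
    (h : ∃ C, B < C ∧ i ≤ c C) : ∃ C, Consecutive c i B C := by
  obtain ⟨C, ⟨hBC, hC⟩, hmin⟩ := exists_first h
  refine ⟨C, hB, hC, hBC, fun D hD hDC => ?_⟩
  by_contra! hge
  exact absurd (hmin D ⟨hD, hge⟩) (by simpa using hDC)

theorem EvenLabelled.le_height {c : Fin k → ℕ} {i : ℕ} {U : Set (Line k)} {C : Fin k}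
    (h : EvenLabelled c i U C) : i ≤ c C := by
  rcases h with h | ⟨B, h⟩
  exacts [h.1, h.1.2.1]

theorem OddLabelled.le_height {c : Fin k → ℕ} {i : ℕ} {U : Set (Line k)} {C : Fin k}
    (h : OddLabelled c i U C) : i ≤ c C := by
  rcases h with h | ⟨B, h⟩
  exacts [h.1, h.1.1]

/-! ### Labelled columns and the new lines they produce -/

namespace LinkedUp

variable {c : Fin k → ℕ} {i : ℕ} {U : Set (Line k)} (hU : LinkedUp c i U)
include hU

/-- The right one of two even columns ends a cut, and its last line begins inside that cut, hence
not before the left one. -/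
theorem even_unique {C C' : Fin k} {l : Line k} (hC : EvenLabelled c (i + 1) U C)
    (hC' : EvenLabelled c (i + 1) U C') (h : IsLastBefore U C l) (h' : IsLastBefore U C' l) :
    C = C' := by
  have key : ∀ {C C' : Fin k}, EvenLabelled c (i + 1) U C → EvenLabelled c (i + 1) U C' →
      IsLastBefore U C l → IsLastBefore U C' l → C' ≤ C := by
    intro C C' hC hC' h h'
    by_contra! hlt
    rcases hC' with hC' | ⟨B, hB⟩
    · exact absurd (hC'.2 C hC.le_height) (by simpa using hlt)
    · obtain ⟨m, hm, hBm⟩ := exists_isLastBefore_of_isCut hB hU.col_lt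
      obtain rfl := hU.isLastBefore_unique hm h'
      have h1 := hB.1.2.2.2 C (hBm.trans_lt h.2.1) hlt
      have := hC.le_height
      omega
  exact le_antisymm (key hC' hC h' h) (key hC hC' h h')

/-- The left one of two odd columns begins a cut containing a line, so its first line ends inside
that cut, hence not after the right one. -/
theorem odd_unique {C C' : Fin k} {l : Line k} (hC : OddLabelled c (i + 1) U C)
    (hC' : OddLabelled c (i + 1) U C') (h : IsFirstAfter U C l) (h' : IsFirstAfter U C' l) :
    C = C' := by
  have key : ∀ {C C' : Fin k}, OddLabelled c (i + 1) U C → OddLabelled c (i + 1) U C' →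
      IsFirstAfter U C l → IsFirstAfter U C' l → C' ≤ C := by
    intro C C' hC hC' h h'
    by_contra! hlt
    rcases hC with hC | ⟨B, hB, l₀, hl₀, h1, h2⟩
    · exact absurd (hC.2 C' hC'.le_height) (by simpa using hlt)
    · have h3 := h.2.2 l₀ hl₀ (h1.trans_lt (hU.col_lt _ hl₀))
      have h4 := hB.2.2.2 C' hlt (h'.2.1.trans_le (h3.trans h2))
      have := hC'.le_height
      omega
  exact le_antisymm (key hC' hC h' h) (key hC hC' h h')

/-- A line with a column of height greater than `i` between it and the following line is the last
one before an even labelled column. -/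
theorem exists_even {p m : Line k} (hpm : IsNext U p m) {C : Fin k} (hC : i < c C)
    (hpC : p.right.col ≤ C) (hCm : C < m.right.col) :
    ∃ C', EvenLabelled c (i + 1) U C' ∧ IsLastBefore U C' p := by
  -- The first tall column after `p` is either `C₀` or the end of a cut that contains `p`.
  obtain ⟨C', ⟨hC', hpC'⟩, hmin⟩ :=
    exists_first (p := fun D => i < c D ∧ p.right.col ≤ D) ⟨C, hC, hpC⟩
  have hC'C : C' ≤ C := hmin C ⟨hC, hpC⟩
  have hp := hU.col_lt p hpm.1
  refine ⟨C', ?_, hpm.1, hp.trans_le hpC', fun q hq hqC' => ?_⟩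
  · by_cases hleft : ∃ B, B < C' ∧ i + 1 ≤ c B
    · obtain ⟨B, hB⟩ := exists_consecutive_left hC' hleft
      refine Or.inr ⟨B, hB, p, hpm.1, hU.le_left hpm.1 hB.1 ?_, hpC'⟩
      by_contra! hle
      exact absurd (hmin B ⟨hB.1, hle⟩) (by simpa using hB.2.2.1)
    · push Not at hleft
      refine Or.inl ⟨hC', fun D hD => ?_⟩
      by_contra! hlt
      have := hleft D hlt
      omega
  · by_contra! hlt
    have hmq : m.left.col ≤ q.left.col := by
      by_contra! hqm
      exact hpm.2.2.2 q hq ⟨hlt, hqm⟩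
    have h1 := hU.right_le hq hC' hqC'
    have h2 : m.right.col ≤ q.right.col := by
      rcases hmq.lt_or_eq with h | h
      · exact ((hU.left_lt_iff hpm.2.1 hq).1 h).le
      · rw [hU.ext_left hpm.2.1 hq h]
    exact absurd (h2.trans (h1.trans hC'C)) (by simpa using hCm)

/-- A line with a column of height greater than `i` to its left is the end of a new line. -/
theorem exists_new_of_column {x : Line k} (hx : x ∈ U) {E : Fin k} (hE : i < c E)
    (hEx : E < x.right.col) :
    ∃ y ∈ newOdd c (i + 1) U ∪ newLoose c (i + 1) U, y.right = x.right := by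
  -- The last tall column before the end of `x` is either the rightmost one or the beginning of a
  -- cut that contains `x`.
  obtain ⟨C, ⟨hC, hCx⟩, hmax⟩ :=
    exists_last (p := fun D => i < c D ∧ D < x.right.col) ⟨E, hE, hEx⟩
  have hodd : OddLabelled c (i + 1) U C := by
    by_cases hright : ∃ B, C < B ∧ i + 1 ≤ c B
    · obtain ⟨B, hB⟩ := exists_consecutive_right hC hright
      refine Or.inr ⟨B, hB, x, hx, hU.le_left hx hC hCx, ?_⟩
      by_contra! hlt
      exact absurd (hmax B ⟨hB.2.1, hlt⟩) (by simpa using hB.2.2.1)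
    · push Not at hright
      refine Or.inl ⟨hC, fun D hD => ?_⟩
      by_contra! hlt
      have := hright D hlt
      omega
  by_cases hfirst : IsFirstAfter U C x
  · exact ⟨_, Or.inl ⟨C, x, hodd, hfirst, rfl⟩, rfl⟩
  -- Here the predecessor `p` of `x` ends after `C`, so no tall column separates them, `p` is not
  -- last before an even column, and its loose end is joined to the end of `x`.
  · have : ∃ q ∈ U, C < q.right.col ∧ q.right.col < x.right.col := by
      by_contra! hno
      exact hfirst ⟨hx, hCx, hno⟩
    obtain ⟨q, hq, hCq, hqx⟩ := this
    obtain ⟨p, hp⟩ := exists_isNext hx ⟨q, hq, (hU.left_lt_iff hq hx).2 hqx⟩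
    have hqp : q.right.col ≤ p.right.col := by
      by_contra! hlt
      exact hp.2.2.2 q hq ⟨(hU.left_lt_iff hp.1 hq).2 hlt, (hU.left_lt_iff hq hx).2 hqx⟩
    refine ⟨_, Or.inr ⟨p, x, hp, ?_, rfl⟩, rfl⟩
    rintro ⟨C', hC', hlast⟩
    have h1 : C' ≤ x.left.col := by
      by_contra! hlt
      exact absurd (hlast.2.2 x hx hlt) (by simpa using hp.2.2.1)
    have h2 := hmax C' ⟨hC'.le_height, h1.trans_lt (hU.col_lt x hx)⟩
    have h3 := hU.right_le hp.1 hC'.le_height hlast.2.1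
    exact absurd (h3.trans h2) (by simpa using hCq.trans_le hqp)

/-- A line with a line to its left is the end of a new line. -/
theorem exists_new_of_line {x : Line k} (hx : x ∈ U) (h : ∃ l ∈ U, l.left.col < x.left.col) :
    ∃ y ∈ newOdd c (i + 1) U ∪ newLoose c (i + 1) U, y.right = x.right := by
  obtain ⟨p, hp⟩ := exists_isNext hx h
  by_cases hlast : ∃ C, EvenLabelled c (i + 1) U C ∧ IsLastBefore U C p
  · obtain ⟨C, hC, hlast⟩ := hlast
    refine hU.exists_new_of_column hx (E := C) hC.le_height ?_
    refine lt_of_le_of_lt ?_ (hU.col_lt x hx)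
    by_contra! hlt
    exact absurd (hlast.2.2 x hx hlt) (by simpa using hp.2.2.1)
  · exact ⟨_, Or.inr ⟨p, x, hp, hlast, rfl⟩, rfl⟩

end LinkedUp

/-! ### The invariant of the stages -/

/-- The lines of a labelling which have not been gated. -/
def Labelling.active (S : Labelling k) : Set (Line k) :=
  S.one ∪ S.ungated

/-- The condition satisfied by the boxes of the first `i` rows at which no active line ends after
the `i`-th stage. -/
def IsStart (c : Fin k → ℕ) (i : ℕ) (b : Box k) : Prop :=
  -- First kind: the leftmost column reaching this row. Two columns shorter by one before it would
  -- provide a line of `U` to be joined to `C₀`.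
  ((∀ E < b.col, c E < b.row) ∧ ∀ E F, E < F → F < b.col → c E + 1 = b.row → c F + 1 ≠ b.row) ∨
  -- Second kind: the second column of its height, with none taller before it. The line ending there
  -- is gated at stage `b.row + 1` and no new line replaces it.
  (b.row < i ∧ c b.col = b.row ∧ (∃ E < b.col, c E = b.row) ∧ (∀ E < b.col, c E ≤ b.row) ∧
    ∀ E F, E < F → F < b.col → c E = b.row → c F ≠ b.row)

/-- The properties of the lines present after the `i`-th stage which are kept by the stages. -/
structure Regular (c : Fin k → ℕ) (i : ℕ) (S : Labelling k) : Prop where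
  left_box : ∀ x ∈ S.active ∪ S.gated, IsBox c x.left
  right_box : ∀ x ∈ S.active ∪ S.gated, IsBox c x.right
  col_lt : ∀ x ∈ S.active ∪ S.gated, x.left.col < x.right.col
  -- With the next field: below row `i` the lines are still the original horizontal ones, and no
  -- line crosses between these rows and the first `i`.
  rows : ∀ x ∈ S.active ∪ S.gated, x.InRows i ∨ JoinsAdjacent c x ∧ i < x.right.row
  horizontal : ∀ x, JoinsAdjacent c x → i < x.right.row → x ∈ S.active
  disjoint : ∀ x ∈ S.one, x ∉ S.ungated
  ext_right : ∀ x ∈ S.active, ∀ y ∈ S.active, x.right = y.right → x = y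
  ext_left : ∀ x ∈ S.active, ∀ y ∈ S.active, x.left = y.left → x = y
  ungated_row : ∀ x ∈ S.ungated, i ≤ x.right.row
  ungated_height : ∀ x ∈ S.ungated, c x.right.col = x.right.row
  ungated_neighbour : ∀ x ∈ S.ungated, ∃ E < x.right.col, c E = c x.right.col
  ungated_adj : ∀ x ∈ S.ungated, ∀ D, x.left.col < D → D < x.right.col → c D < x.right.row
  exists_ungated : ∀ D, i ≤ c D → (∃ E < D, c E = c D) → ∃ x ∈ S.ungated, x.right = ⟨D, c D⟩
  isStart : ∀ b, IsBox c b → b.row ≤ i → (∀ x ∈ S.active, x.right ≠ b) → IsStart c i b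
  gated_row : ∀ x ∈ S.gated, x.right.row < i
  -- Reading columns from left to right and each column upwards, the active line begins before the
  -- gated one.
  gated_lt : ∀ x ∈ S.gated, ∀ y ∈ S.active, x.right = y.right →
    y.left.col < x.left.col ∨ y.left.col = x.left.col ∧ x.left.row < y.left.row

theorem exists_joinsAdjacent {c : Fin k → ℕ} {D : Fin k} {r : ℕ} (hr : 1 ≤ r) (hD : r ≤ c D)
    (h : ∃ E < D, r ≤ c E) : ∃ B, Consecutive c r B D ∧ JoinsAdjacent c ⟨⟨B, r⟩, ⟨D, r⟩⟩ := by
  obtain ⟨B, hB⟩ := exists_consecutive_left hD h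
  exact ⟨B, hB, ⟨hr, hB.1⟩, ⟨hr, hB.2.1⟩, rfl, hB.2.2.1, hB.2.2.2⟩

theorem JoinsAdjacent.consecutive {c : Fin k → ℕ} {x : Line k} (h : JoinsAdjacent c x) :
    Consecutive c x.right.row x.left.col x.right.col := by
  obtain ⟨h1, h2, h3, h4, h5⟩ := h
  exact ⟨h3 ▸ h1.2, h2.2, h4, fun D hD hD' => h3 ▸ h5 D hD hD'⟩

theorem JoinsAdjacent.eq_mk {c : Fin k → ℕ} {x : Line k} (h : JoinsAdjacent c x) :
    x = ⟨⟨x.left.col, x.right.row⟩, ⟨x.right.col, x.right.row⟩⟩ := by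
  ext <;> simp [h.2.2.1]

theorem JoinsAdjacent.ext_right {c : Fin k → ℕ} {x y : Line k} (hx : JoinsAdjacent c x)
    (hy : JoinsAdjacent c y) (h : x.right = y.right) : x = y := by
  have h1 := hx.consecutive
  rw [h] at h1
  rw [hx.eq_mk, hy.eq_mk, h, h1.left_unique hy.consecutive]

theorem JoinsAdjacent.ext_left {c : Fin k → ℕ} {x y : Line k} (hx : JoinsAdjacent c x)
    (hy : JoinsAdjacent c y) (h : x.left = y.left) : x = y := by
  have hrow : x.right.row = y.right.row := by rw [← hx.2.2.1, ← hy.2.2.1, h]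
  have h1 := hx.consecutive
  rw [h, hrow] at h1
  rw [hx.eq_mk, hy.eq_mk, h, hrow, h1.right_unique hy.consecutive]

theorem exists_neighbouring {c : Fin k → ℕ} {D : Fin k} (h : ∃ E < D, c E = c D) :
    ∃ E, Neighbouring c E D := by
  obtain ⟨E, ⟨hED, hE⟩, hmax⟩ := exists_last h
  refine ⟨E, hED, hE, fun F hF hFD hc => ?_⟩
  exact absurd (hmax F ⟨hFD, hc⟩) (by simpa using hF)

theorem regular_initial (c : Fin k → ℕ) (hc : ∀ j, 1 ≤ c j) : Regular c 0 (initial c) := by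
  have hact : ∀ x, x ∈ (initial c).active ↔ JoinsAdjacent c x := by
    intro x
    constructor
    · rintro (h | h)
      exacts [h.1, h.1]
    · intro h
      by_cases hs : CarriesStar c x
      exacts [Or.inr hs, Or.inl ⟨h, hs⟩]
  have hall : ∀ x ∈ (initial c).active ∪ (initial c).gated, JoinsAdjacent c x := by
    rintro x (h | h)
    · exact (hact x).1 h
    · exact h.elim
  exact
    { left_box := fun x hx => (hall x hx).1
      right_box := fun x hx => (hall x hx).2.1
      col_lt := fun x hx => (hall x hx).2.2.2.1
      rows := fun x hx => Or.inr ⟨hall x hx, (hall x hx).2.1.1⟩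
      horizontal := fun x hx _ => (hact x).2 hx
      disjoint := fun x hx hx' => hx.2 hx'
      ext_right := fun x hx y hy h => ((hact x).1 hx).ext_right ((hact y).1 hy) h
      ext_left := fun x hx y hy h => ((hact x).1 hx).ext_left ((hact y).1 hy) h
      ungated_row := fun _ _ => Nat.zero_le _
      ungated_height := fun x hx => hx.2.1.symm
      ungated_neighbour := fun x hx => hx.2.2.imp fun E hE => ⟨hE.1, hE.2.1⟩
      ungated_adj := fun x hx => hx.1.consecutive.2.2.2
      exists_ungated := fun D _ h => by
        obtain ⟨B, -, hB⟩ := exists_joinsAdjacent (hc D) le_rfl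
          (h.imp fun E hE => ⟨hE.1, hE.2.ge⟩)
        exact ⟨_, ⟨hB, rfl, exists_neighbouring h⟩, rfl⟩
      isStart := fun b hb h0 => by have := hb.1; omega
      gated_row := fun x hx => hx.elim
      gated_lt := fun x hx => hx.elim }

/-- The new lines of a stage. -/
def newLines (c : Fin k → ℕ) (i : ℕ) (U : Set (Line k)) : Set (Line k) :=
  newEven c i U ∪ newOdd c i U ∪ newLoose c i U

theorem newStar_subset {c : Fin k → ℕ} {i : ℕ} {S : Labelling k} {U : Set (Line k)} :
    newStar c i S U ⊆ newEven c i U := by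
  rintro x ⟨B, C, l, hcut, -, hl, rfl⟩
  exact ⟨C, l, Or.inr ⟨B, hcut⟩, hl, rfl⟩

/-! ### Preservation of the invariant by a stage -/

namespace Regular

variable {c : Fin k → ℕ} {i : ℕ} {S : Labelling k} (h : Regular c i S)
include h

omit h in
theorem ungatedIn_subset {x : Line k} (hx : x ∈ S.ungatedIn i) : x ∈ S.active :=
  Or.inr hx.1

/-- The ends lie in row at most `i` because the lines do, and in row at least `i` by `ungated_row`.
-/
theorem linkedUp : LinkedUp c i (S.ungatedIn i) := by
  have hrow : ∀ x ∈ S.ungatedIn i, x.right.row = i := fun x hx =>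
    le_antisymm hx.2.2 (h.ungated_row x hx.1)
  have hheight : ∀ x ∈ S.ungatedIn i, c x.right.col = i := fun x hx => by
    rw [h.ungated_height x hx.1, hrow x hx]
  exact
    { left_box := fun x hx => h.left_box x (Or.inl (ungatedIn_subset hx))
      left_row := fun x hx => hx.2.1
      right_row := hrow
      height := hheight
      col_lt := fun x hx => h.col_lt x (Or.inl (ungatedIn_subset hx))
      adj := fun x hx D h1 h2 => hrow x hx ▸ h.ungated_adj x hx.1 D h1 h2
      ext := fun x hx y hy hxy => h.ext_right x (ungatedIn_subset hx) y (ungatedIn_subset hy)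
        (Box.ext hxy (by rw [hrow x hx, hrow y hy])) }

omit h in
theorem gated_step : (step c (i + 1) S).gated = S.gated ∪ S.ungatedIn i := rfl

omit h in
theorem ungated_step : (step c (i + 1) S).ungated =
    (S.ungated \ (S.ungatedIn i ∪ deletedLines c (i + 1) (S.ungatedIn i))) ∪
      newStar c (i + 1) S (S.ungatedIn i) := rfl

theorem active_step : (step c (i + 1) S).active =
    (S.active \ (S.ungatedIn i ∪ deletedLines c (i + 1) (S.ungatedIn i))) ∪
      newLines c (i + 1) (S.ungatedIn i) := by
  ext x
  have h1 : (step c (i + 1) S).one = (S.one \ deletedLines c (i + 1) (S.ungatedIn i)) ∪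
    (newLines c (i + 1) (S.ungatedIn i) \ newStar c (i + 1) S (S.ungatedIn i)) := rfl
  have h2 : x ∈ S.one → x ∉ S.ungatedIn i := fun hx hx' => h.disjoint x hx hx'.1
  have h3 : x ∈ newStar c (i + 1) S (S.ungatedIn i) → x ∈ newLines c (i + 1) (S.ungatedIn i) :=
    fun hx => Or.inl (Or.inl (newStar_subset hx))
  simp only [Labelling.active, h1, ungated_step, Set.mem_union, Set.mem_sdiff]
  tauto

theorem of_row_lt {x : Line k} (hx : x ∈ S.active) (hr : i < x.right.row) :
    JoinsAdjacent c x := by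
  rcases h.rows x (Or.inl hx) with h' | h'
  · exact absurd h'.2 (by omega)
  · exact h'.1

theorem of_left_row_lt {x : Line k} (hx : x ∈ S.active) (hr : i < x.left.row) :
    JoinsAdjacent c x := by
  rcases h.rows x (Or.inl hx) with h' | h'
  · exact absurd h'.1 (by omega)
  · exact h'.1

omit h in
theorem mem_deletedLines {x : Line k} (hx : JoinsAdjacent c x) (hr : x.right.row = i + 1)
    {U : Set (Line k)} {B : Fin k} (hB : IsCut c (i + 1) U B x.right.col) :
    x ∈ deletedLines c (i + 1) U := by
  have := hx.consecutive
  rw [hr] at this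
  obtain rfl := this.left_unique hB.1
  exact ⟨_, _, hB, by rw [← hr]; exact hx.eq_mk⟩

omit h in
theorem mem_deletedLines_left {x : Line k} (hx : JoinsAdjacent c x) (hr : x.right.row = i + 1)
    {U : Set (Line k)} {B : Fin k} (hB : IsCut c (i + 1) U x.left.col B) :
    x ∈ deletedLines c (i + 1) U := by
  have := hx.consecutive
  rw [hr] at this
  obtain rfl := this.right_unique hB.1
  exact ⟨_, _, hB, by rw [← hr]; exact hx.eq_mk⟩

/-- No line which is kept ends where a new line does. -/
theorem right_ne_of_new {x y : Line k} (hx : x ∈ S.active)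
    (hxU : x ∉ S.ungatedIn i ∪ deletedLines c (i + 1) (S.ungatedIn i))
    (hy : y ∈ newLines c (i + 1) (S.ungatedIn i)) : x.right ≠ y.right := by
  intro hxy
  rcases hy with (⟨C, l, hC, hl, rfl⟩ | ⟨C, l, hC, hl, rfl⟩) | ⟨l, m, hlm, -, rfl⟩
  · have hr : x.right.row = i + 1 := by rw [hxy]
    have hadj := h.of_row_lt hx (by omega)
    have hcol : x.right.col = C := by rw [hxy]
    -- No horizontal line of row `i + 1` ends in its leftmost column, and the one ending a cut is
    -- deleted.
    rcases hC with hC | ⟨B, hB⟩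
    · have h1 := hadj.consecutive
      rw [hr, hcol] at h1
      exact absurd (hC.2 _ h1.1) (by simpa using h1.2.2.1)
    · exact hxU (Or.inr (mem_deletedLines hadj hr (hcol ▸ hB)))
  · rw [h.ext_right x hx l (ungatedIn_subset hl.1) hxy] at hxU
    exact hxU (Or.inl hl.1)
  · rw [h.ext_right x hx m (ungatedIn_subset hlm.2.1) hxy] at hxU
    exact hxU (Or.inl hlm.2.1)

/-- No line which is kept begins where a new line does. -/
theorem left_ne_of_new {x y : Line k} (hx : x ∈ S.active)
    (hxU : x ∉ S.ungatedIn i ∪ deletedLines c (i + 1) (S.ungatedIn i))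
    (hy : y ∈ newLines c (i + 1) (S.ungatedIn i)) : x.left ≠ y.left := by
  intro hxy
  rcases hy with (⟨C, l, hC, hl, rfl⟩ | ⟨C, l, hC, hl, rfl⟩) | ⟨l, m, hlm, -, rfl⟩
  · rw [h.ext_left x hx l (ungatedIn_subset hl.1) hxy] at hxU
    exact hxU (Or.inl hl.1)
  · have hr : x.left.row = i + 1 := by rw [hxy]
    have hadj := h.of_left_row_lt hx (by omega)
    have hr' : x.right.row = i + 1 := by rw [← hadj.2.2.1, hr]
    have hcol : x.left.col = C := by rw [hxy]
    rcases hC with hC | ⟨B, hB⟩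
    · have h1 := hadj.consecutive
      rw [hr', hcol] at h1
      exact absurd (hC.2 _ h1.2.1) (by simpa using h1.2.2.1)
    · exact hxU (Or.inr (mem_deletedLines_left hadj hr' (hcol ▸ hB)))
  · rw [h.ext_left x hx l (ungatedIn_subset hlm.1) hxy] at hxU
    exact hxU (Or.inl hlm.1)

/-- Lines of `newEven` end in row `i + 1`, the others in row `i`, so only `newOdd` and `newLoose`
can clash. A clash would put a tall column between a line and its predecessor, which `exists_even`
then joins to an even column, so that it has no loose end. -/
theorem new_ext_right {x y : Line k} (hx : x ∈ newLines c (i + 1) (S.ungatedIn i))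
    (hy : y ∈ newLines c (i + 1) (S.ungatedIn i)) (hxy : x.right = y.right) : x = y := by
  have hU := h.linkedUp
  have eq_of_right : ∀ l ∈ S.ungatedIn i, ∀ m ∈ S.ungatedIn i, l.right = m.right → l = m :=
    fun l hl m hm hlm => hU.ext l hl m hm (by rw [hlm])
  have odd_loose : ∀ C l p, OddLabelled c (i + 1) (S.ungatedIn i) C →
      IsFirstAfter (S.ungatedIn i) C l → IsNext (S.ungatedIn i) p l →
      (¬ ∃ C', EvenLabelled c (i + 1) (S.ungatedIn i) C' ∧ IsLastBefore (S.ungatedIn i) C' p) →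
      False := by
    intro C l p hC hl hp hno
    refine hno (hU.exists_even hp hC.le_height ?_ hl.2.1)
    by_contra! hlt
    exact absurd (hl.2.2 p hp.1 hlt)
      (by simpa using (hU.left_lt_iff hp.1 hp.2.1).1 hp.2.2.1)
  rcases hx with (⟨C, l, hC, hl, rfl⟩ | ⟨C, l, hC, hl, rfl⟩) | ⟨l, m, hlm, hno, rfl⟩ <;>
    rcases hy with (⟨C', l', hC', hl', rfl⟩ | ⟨C', l', hC', hl', rfl⟩) | ⟨l', m', hlm', hno', rfl⟩
  · simp only [Box.mk.injEq, and_true] at hxy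
    subst hxy
    rw [hU.isLastBefore_unique hl hl']
  · have := hU.right_row _ hl'.1
    rw [← hxy] at this
    simp at this
  · have := hU.right_row _ hlm'.2.1
    rw [← hxy] at this
    simp at this
  · have := hU.right_row _ hl.1
    rw [hxy] at this
    simp at this
  · obtain rfl := eq_of_right l hl.1 l' hl'.1 hxy
    rw [hU.odd_unique hC hC' hl hl']
  · obtain rfl := eq_of_right l hl.1 m' hlm'.2.1 hxy
    exact (odd_loose _ _ _ hC hl hlm' hno').elim
  · have := hU.right_row _ hlm.2.1
    rw [hxy] at this
    simp at this
  · obtain rfl := eq_of_right m hlm.2.1 l' hl'.1 hxy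
    exact (odd_loose _ _ _ hC' hl' hlm hno).elim
  · obtain rfl := eq_of_right m hlm.2.1 m' hlm'.2.1 hxy
    rw [hU.isNext_unique_left hlm hlm']

/-- Rows separate `newOdd` from the rest, and the exception in `newLoose` separates it from
`newEven`. -/
theorem new_ext_left {x y : Line k} (hx : x ∈ newLines c (i + 1) (S.ungatedIn i))
    (hy : y ∈ newLines c (i + 1) (S.ungatedIn i)) (hxy : x.left = y.left) : x = y := by
  have hU := h.linkedUp
  have eq_of_left : ∀ l ∈ S.ungatedIn i, ∀ m ∈ S.ungatedIn i, l.left = m.left → l = m :=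
    fun l hl m hm hlm => hU.ext_left hl hm (by rw [hlm])
  have row_ne : ∀ l ∈ S.ungatedIn i, ∀ C, l.left ≠ ⟨C, i + 1⟩ := by
    intro l hl C hlC
    have := hU.left_row l hl
    rw [hlC] at this
    simp at this
  rcases hx with (⟨C, l, hC, hl, rfl⟩ | ⟨C, l, hC, hl, rfl⟩) | ⟨l, m, hlm, hno, rfl⟩ <;>
    rcases hy with (⟨C', l', hC', hl', rfl⟩ | ⟨C', l', hC', hl', rfl⟩) | ⟨l', m', hlm', hno', rfl⟩
  · obtain rfl := eq_of_left l hl.1 l' hl'.1 hxy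
    rw [hU.even_unique hC hC' hl hl']
  · exact (row_ne _ hl.1 _ hxy).elim
  · obtain rfl := eq_of_left l hl.1 l' hlm'.1 hxy
    exact (hno' ⟨C, hC, hl⟩).elim
  · exact (row_ne _ hl'.1 _ hxy.symm).elim
  · simp only [Box.mk.injEq, and_true] at hxy
    subst hxy
    rw [hU.isFirstAfter_unique hl hl']
  · exact (row_ne _ hlm'.1 _ hxy.symm).elim
  · obtain rfl := eq_of_left l hlm.1 l' hl'.1 hxy
    exact (hno ⟨C', hC', hl'⟩).elim
  · exact (row_ne _ hlm.1 _ hxy).elim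
  · obtain rfl := eq_of_left l hlm.1 l' hlm'.1 hxy
    rw [hU.isNext_unique_right hlm hlm']

theorem new_geometry {x : Line k} (hx : x ∈ newLines c (i + 1) (S.ungatedIn i)) :
    IsBox c x.left ∧ IsBox c x.right ∧ x.left.col < x.right.col ∧ x.InRows (i + 1) ∧
      i ≤ x.right.row := by
  have hU := h.linkedUp
  have hrb : ∀ l ∈ S.ungatedIn i, IsBox c l.right := fun l hl =>
    h.right_box l (Or.inl (ungatedIn_subset hl))
  rcases hx with (⟨C, l, hC, hl, rfl⟩ | ⟨C, l, hC, hl, rfl⟩) | ⟨l, m, hlm, -, rfl⟩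
  · have := hU.left_row l hl.1
    exact ⟨hU.left_box l hl.1, ⟨by simp, hC.le_height⟩, hl.2.1, ⟨by simp; omega, by simp⟩, by simp⟩
  · have := hU.right_row l hl.1
    exact ⟨⟨by simp, hC.le_height⟩, hrb l hl.1, hl.2.1, ⟨by simp, by simp; omega⟩, this.ge⟩
  · have h1 := hU.right_row m hlm.2.1
    have h2 := hU.left_row l hlm.1
    exact ⟨hU.left_box l hlm.1, hrb m hlm.2.1, hlm.2.2.1.trans (hU.col_lt m hlm.2.1),
      ⟨by simp; omega, by simp; omega⟩, h1.ge⟩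

theorem isStart_step {b : Box k} (hb : IsBox c b) (hbi : b.row ≤ i + 1)
    (hno : ∀ x ∈ (step c (i + 1) S).active, x.right ≠ b) : IsStart c (i + 1) b := by
  have hU := h.linkedUp
  rw [h.active_step] at hno
  have hnew : ∀ y ∈ newLines c (i + 1) (S.ungatedIn i), y.right ≠ b := fun y hy =>
    hno y (Or.inr hy)
  -- Of two columns of height `i`, the right one is the end of a line of `U`.
  have hexists : ∀ E F : Fin k, E < F → c E = i → c F = i →
      ∃ x ∈ S.ungatedIn i, x.right = ⟨F, i⟩ := by
    intro E F hEF hE hF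
    obtain ⟨x, hx, hxr⟩ := h.exists_ungated F hF.ge ⟨E, hEF, hE.trans hF.symm⟩
    refine ⟨x, ⟨hx, ?_⟩, by rw [hxr, hF]⟩
    rcases h.rows x (Or.inl (Or.inr hx)) with h' | h'
    · exact h'
    · rw [hxr] at h'
      simp [hF] at h'
  rcases hbi.lt_or_eq with hlt | heq
  · have hbi' : b.row ≤ i := by omega
    by_cases hold : ∀ x ∈ S.active, x.right ≠ b
    · rcases h.isStart b hb hbi' hold with h' | h'
      · exact Or.inl h'
      · exact Or.inr ⟨by omega, h'.2⟩
    · push Not at hold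
      obtain ⟨x, hx, rfl⟩ := hold
      have hxU : x ∈ S.ungatedIn i ∪ deletedLines c (i + 1) (S.ungatedIn i) := by
        by_contra hxU
        exact hno x (Or.inl ⟨hx, hxU⟩) rfl
      rcases hxU with hxU | ⟨C, C', -, rfl⟩
      · have hnew' : ∀ y ∈ newOdd c (i + 1) (S.ungatedIn i) ∪ newLoose c (i + 1) (S.ungatedIn i),
            y.right ≠ x.right := by
          rintro y (hy | hy)
          exacts [hnew y (Or.inl (Or.inr hy)), hnew y (Or.inr hy)]
        have hrow := hU.right_row x hxU
        have hht := hU.height x hxU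
        -- A taller column before `x.right`, or a second earlier column of height `i`, would produce
        -- a new line ending there.
        refine Or.inr ⟨by omega, by omega, ?_, fun E hE => ?_, fun E F hEF hF hEr hFr => ?_⟩
        · obtain ⟨E, hE, hcE⟩ := h.ungated_neighbour x hxU.1
          exact ⟨E, hE, by omega⟩
        · by_contra! hgt
          obtain ⟨y, hy, hyx⟩ := hU.exists_new_of_column hxU (E := E) (by omega) hE
          exact hnew' y hy hyx
        · obtain ⟨l, hl, hlF⟩ := hexists E F hEF (by omega) (by omega)
          have hlc : l.right.col = F := by rw [hlF]
          obtain ⟨y, hy, hyx⟩ := hU.exists_new_of_line hxU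
            ⟨l, hl, (hU.left_lt_iff hl hxU).2 (by rw [hlc]; exact hF)⟩
          exact hnew' y hy hyx
      · simp at hbi'
  -- With a tall column to the left, the horizontal line into `b` is either kept or replaced by a
  -- new even line. So `b` lies in `C₀`.
  · have hleft : ∀ E < b.col, c E < i + 1 := by
      by_contra! hE
      obtain ⟨B, -, hB⟩ := exists_joinsAdjacent (c := c) (D := b.col) (r := b.row) hb.1 hb.2
        (by simpa [heq] using hE)
      have hx := h.horizontal _ hB (by simp; omega)
      by_cases hxU : (⟨⟨B, b.row⟩, ⟨b.col, b.row⟩⟩ : Line k) ∈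
          S.ungatedIn i ∪ deletedLines c (i + 1) (S.ungatedIn i)
      · rcases hxU with hxU | ⟨C, C', hC, hCC⟩
        · have := hU.right_row _ hxU
          simp at this
          omega
        · simp only [Line.mk.injEq, Box.mk.injEq] at hCC
          obtain ⟨l, hl, -⟩ := LinkedUp.exists_isLastBefore_of_isCut hC hU.col_lt
          refine hnew _ (Or.inl (Or.inl ⟨C', l, Or.inr ⟨C, hC⟩, hl, rfl⟩)) ?_
          ext <;> simp [hCC.2.1, heq]
      · exact hno _ (Or.inl ⟨hx, hxU⟩) rfl
    refine Or.inl ⟨by rwa [heq], fun E F hEF hF hEr hFr => ?_⟩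
    obtain ⟨l, hl, hlF⟩ := hexists E F hEF (by omega) (by omega)
    have hlF' : l.left.col < F := by have := hU.col_lt l hl; rwa [hlF] at this
    obtain ⟨m, hm⟩ := LinkedUp.exists_isLastBefore (C := b.col) ⟨l, hl, hlF'.trans hF⟩
    refine hnew _ (Or.inl (Or.inl ⟨b.col, m, Or.inl ⟨heq ▸ hb.2, fun D hD => ?_⟩, hm, rfl⟩)) ?_
    · by_contra! hlt
      have := hleft D hlt
      omega
    · ext <;> simp [heq]

theorem step : Regular c (i + 1) (step c (i + 1) S) := by
  have hU := h.linkedUp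
  have hmem : ∀ x ∈ (MaximalGating.step c (i + 1) S).active ∪ (MaximalGating.step c (i + 1) S).gated,
      (x ∈ S.active ∪ S.gated ∧ x ∉ deletedLines c (i + 1) (S.ungatedIn i)) ∨
        x ∈ newLines c (i + 1) (S.ungatedIn i) := by
    rw [h.active_step, gated_step]
    have hdel : ∀ x ∈ deletedLines c (i + 1) (S.ungatedIn i), i < x.right.row := by
      rintro x ⟨C, C', -, rfl⟩
      simp
    rintro x ((hx | hx) | (hx | hx))
    · exact Or.inl ⟨Or.inl hx.1, fun h' => hx.2 (Or.inr h')⟩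
    · exact Or.inr hx
    · exact Or.inl ⟨Or.inr hx, fun h' => by have := h.gated_row x hx; have := hdel x h'; omega⟩
    · exact Or.inl ⟨Or.inl (ungatedIn_subset hx),
        fun h' => by have := hU.right_row x hx; have := hdel x h'; omega⟩
  have hdel_iff : ∀ x, x ∈ deletedLines c (i + 1) (S.ungatedIn i) → x.right.row = i + 1 := by
    rintro x ⟨C, C', -, rfl⟩
    rfl
  refine
    { left_box := fun x hx => ?_
      right_box := fun x hx => ?_
      col_lt := fun x hx => ?_
      rows := fun x hx => ?_
      horizontal := fun x hx hr => ?_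
      disjoint := ?_
      ext_right := ?_
      ext_left := ?_
      ungated_row := fun x hx => ?_
      ungated_height := fun x hx => ?_
      ungated_neighbour := fun x hx => ?_
      ungated_adj := fun x hx => ?_
      exists_ungated := fun D hD hE => ?_
      isStart := fun b hb hbi hno => h.isStart_step hb hbi hno
      gated_row := fun x hx => ?_
      gated_lt := ?_ }
  · rcases hmem x hx with h' | h'
    exacts [h.left_box x h'.1, (h.new_geometry h').1]
  · rcases hmem x hx with h' | h'
    exacts [h.right_box x h'.1, (h.new_geometry h').2.1]
  · rcases hmem x hx with h' | h'
    exacts [h.col_lt x h'.1, (h.new_geometry h').2.2.1]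
  · rcases hmem x hx with h' | h'
    · rcases h.rows x h'.1 with hr | ⟨hadj, hr⟩
      · exact Or.inl ⟨hr.1.trans (Nat.le_succ i), hr.2.trans (Nat.le_succ i)⟩
      · by_cases hi : x.right.row ≤ i + 1
        · exact Or.inl ⟨hadj.2.2.1.le.trans hi, hi⟩
        · exact Or.inr ⟨hadj, by omega⟩
    · exact Or.inl (h.new_geometry h').2.2.2.1
  · rw [h.active_step]
    refine Or.inl ⟨h.horizontal x hx (by omega), ?_⟩
    rintro (h' | h')
    · have := hU.right_row x h'
      omega
    · have := hdel_iff x h'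
      omega
  · rintro x (hx | hx) (hx' | hx')
    · exact h.disjoint x hx.1 hx'.1
    · refine h.right_ne_of_new (Or.inl hx.1) ?_ (Or.inl (Or.inl (newStar_subset hx'))) rfl
      rintro (h' | h')
      exacts [h.disjoint x hx.1 h'.1, hx.2 h']
    · exact h.right_ne_of_new (Or.inr hx'.1) hx'.2 hx.1 rfl
    · exact hx.2 hx'
  · rw [h.active_step]
    rintro x (hx | hx) y (hy | hy) hxy
    · exact h.ext_right x hx.1 y hy.1 hxy
    · exact absurd hxy (h.right_ne_of_new hx.1 hx.2 hy)
    · exact absurd hxy.symm (h.right_ne_of_new hy.1 hy.2 hx)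
    · exact h.new_ext_right hx hy hxy
  · rw [h.active_step]
    rintro x (hx | hx) y (hy | hy) hxy
    · exact h.ext_left x hx.1 y hy.1 hxy
    · exact absurd hxy (h.left_ne_of_new hx.1 hx.2 hy)
    · exact absurd hxy.symm (h.left_ne_of_new hy.1 hy.2 hx)
    · exact h.new_ext_left hx hy hxy
  · rcases hx with ⟨hx, hxU⟩ | ⟨B, C, l, -, -, -, rfl⟩
    · rcases h.rows x (Or.inl (Or.inr hx)) with h' | h'
      · exact absurd (Or.inl ⟨hx, h'⟩) hxU
      · exact h'.2
    · exact le_rfl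
  · rcases hx with ⟨hx, hxU⟩ | ⟨B, C, l, -, hB, -, rfl⟩
    exacts [h.ungated_height x hx, h.ungated_height ⟨⟨B, i + 1⟩, ⟨C, i + 1⟩⟩ hB]
  · rcases hx with ⟨hx, hxU⟩ | ⟨B, C, l, -, hB, -, rfl⟩
    exacts [h.ungated_neighbour x hx, h.ungated_neighbour ⟨⟨B, i + 1⟩, ⟨C, i + 1⟩⟩ hB]
  · rcases hx with ⟨hx, hxU⟩ | ⟨B, C, l, hcut, hB, hl, rfl⟩
    · exact h.ungated_adj x hx
    · intro D hlD hDC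
      -- The new starred line begins no further left than the deleted one, so it inherits its
      -- adjacency.
      obtain ⟨m, hm, hBm⟩ := LinkedUp.exists_isLastBefore_of_isCut hcut hU.col_lt
      obtain rfl := hU.isLastBefore_unique hm hl
      exact h.ungated_adj _ hB D (hBm.trans_lt hlD) hDC
  · obtain ⟨x, hx, hxD⟩ := h.exists_ungated D (by omega) hE
    by_cases hxU : x ∈ S.ungatedIn i ∪ deletedLines c (i + 1) (S.ungatedIn i)
    · rcases hxU with hxU | ⟨C, C', hcut, hCC⟩
      · have := hU.right_row x hxU
        rw [hxD] at this
        simp at this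
        omega
      · obtain ⟨l, hl, -⟩ := LinkedUp.exists_isLastBefore_of_isCut hcut hU.col_lt
        exact ⟨_, Or.inr ⟨C, C', l, hcut, hCC ▸ hx, hl, rfl⟩, by rw [← hxD, hCC]⟩
    · exact ⟨x, Or.inl ⟨hx, hxU⟩, hxD⟩
  · rcases hx with hx | hx
    · exact (h.gated_row x hx).trans (Nat.lt_succ_self i)
    · have := hU.right_row x hx
      omega
  · rw [h.active_step]
    rintro x (hx | hx) y (hy | hy) hxy
    · exact h.gated_lt x hx y hy.1 hxy
    · have h1 := h.gated_row x hx
      have h2 := (h.new_geometry hy).2.2.2.2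
      rw [hxy] at h1
      omega
    · rw [h.ext_right x (ungatedIn_subset hx) y hy.1 hxy] at hx
      exact absurd (Or.inl hx) hy.2
    · have hxr := hU.right_row x hx
      rcases hy with (⟨C, l, hC, hl, rfl⟩ | ⟨C, l, hC, hl, rfl⟩) | ⟨l, m, hlm, -, rfl⟩
      · rw [hxy] at hxr
        simp at hxr
      · obtain rfl : x = l := hU.ext x hx l hl.1 (by rw [hxy])
        -- The odd column is tall, hence not inside `x`; if `x` begins in that same column, it does
        -- so above row `i + 1`.
        rcases (hU.le_left hx hC.le_height hl.2.1).lt_or_eq with h' | h'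
        · exact Or.inl h'
        · exact Or.inr ⟨h', Nat.lt_succ_of_le (hU.left_row x hx)⟩
      · obtain rfl : x = m := hU.ext x hx m hlm.2.1 (by rw [hxy])
        exact Or.inl hlm.2.2.1

end Regular

theorem regular_stage (c : Fin k → ℕ) (hc : ∀ j, 1 ≤ c j) (i : ℕ) : Regular c i (stage c i) := by
  induction i with
  | zero => exact regular_initial c hc
  | succ i ih => exact ih.step

/-- Lines are determined by their end columns, so listing these in increasing order lists the lines.
-/
theorem Regular.strictNonOverlapping {c : Fin k → ℕ} {i : ℕ} {S : Labelling k}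
    (h : Regular c i S) : StrictNonOverlapping S i := by
  classical
  have hU := h.linkedUp
  let s : Finset (Fin k) := Finset.univ.filter fun D => ∃ x ∈ S.ungatedIn i, x.right.col = D
  have hs : ∀ j, ∃ x ∈ S.ungatedIn i, x.right.col = s.orderEmbOfFin rfl j := fun j => by
    simpa only [s, Finset.mem_filter_univ] using s.orderEmbOfFin_mem rfl j
  choose l hl hlc using hs
  refine ⟨s.card, l, ?_, fun j => hU.col_lt _ (hl j), fun j j' hjj => ?_⟩
  · ext x
    constructor
    · rintro ⟨j, rfl⟩
      exact hl j
    · intro hx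
      have : x.right.col ∈ Set.range (s.orderEmbOfFin rfl) := by
        rw [Finset.range_orderEmbOfFin]
        simpa [s] using ⟨x, hx, rfl⟩
      obtain ⟨j, hj⟩ := this
      exact ⟨j, hU.ext _ (hl j) _ hx (by rw [hlc, hj])⟩
  · refine hU.right_le_left (hl j) (hl j') ?_
    rw [hlc, hlc]
    exact (s.orderEmbOfFin rfl).strictMono hjj

/-! ### Families of disjoint paths of a relation that increases a function -/

section Families

variable {α ι : Type*} [LinearOrder ι]

/-- `P` is a family of pairwise disjoint paths of the relation `R` which cover `V`. -/
structure IsPathFamily (R : α → α → Prop) (V : Set α) (P : Finset (List α)) : Prop where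
  ne_nil : ∀ p ∈ P, p ≠ []
  chain : ∀ p ∈ P, p.IsChain R
  disjoint : ∀ p ∈ P, ∀ q ∈ P, p ≠ q → p.Disjoint q
  subset : ∀ p ∈ P, ∀ b ∈ p, b ∈ V
  covers : ∀ b ∈ V, ∃ p ∈ P, b ∈ p

/-- `b` follows `a` on one of the paths in `P`. -/
def Follows (P : Finset (List α)) (a b : α) : Prop :=
  ∃ p ∈ P, ∃ n : ℕ, p[n]? = some a ∧ p[n + 1]? = some b

theorem lt_of_isChain {R : α → α → Prop} {f : α → ι} (hR : ∀ a b, R a b → f a < f b) {p : List α}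
    (hp : p.IsChain R) {m n : ℕ} {a b : α} (ha : p[m]? = some a) (hb : p[n]? = some b)
    (hmn : m < n) : f a < f b := by
  have h1 : p.IsChain fun a b => f a < f b := hp.imp fun a b => hR a b
  have : IsTrans α fun a b => f a < f b := ⟨fun _ _ _ h h' => lt_trans h h'⟩
  have h2 := List.isChain_iff_pairwise.1 h1
  rw [List.getElem?_eq_some_iff] at ha hb
  obtain ⟨hm, rfl⟩ := ha
  obtain ⟨hn, rfl⟩ := hb
  exact List.pairwise_iff_getElem.1 h2 m n hm hn hmn

theorem index_lt_of_isChain {R : α → α → Prop} {f : α → ι} (hR : ∀ a b, R a b → f a < f b)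
    {p : List α} (hp : p.IsChain R) {m n : ℕ} {a b : α} (ha : p[m]? = some a)
    (hb : p[n]? = some b) (hab : f a < f b) : m < n := by
  by_contra! hnm
  rcases hnm.lt_or_eq with h | rfl
  · exact absurd (lt_of_isChain hR hp hb ha h) (by simpa using hab.le)
  · rw [ha] at hb
    obtain rfl := Option.some.inj hb
    exact lt_irrefl _ hab

theorem index_eq_of_isChain {R : α → α → Prop} {f : α → ι} (hR : ∀ a b, R a b → f a < f b)
    {p : List α} (hp : p.IsChain R) {m n : ℕ} {a b : α} (ha : p[m]? = some a)
    (hb : p[n]? = some b) (hab : f a = f b) : m = n := by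
  rcases lt_trichotomy m n with h | h | h
  · exact absurd (lt_of_isChain hR hp ha hb h) (by simp [hab])
  · exact h
  · exact absurd (lt_of_isChain hR hp hb ha h) (by simp [hab])

theorem eq_of_isChain_of_mem {R : α → α → Prop} {f : α → ι} (hR : ∀ a b, R a b → f a < f b)
    {p : List α} (hp : p.IsChain R) {a b : α} (ha : a ∈ p) (hb : b ∈ p) (hab : f a = f b) :
    a = b := by
  obtain ⟨m, ha⟩ := List.mem_iff_getElem?.1 ha
  obtain ⟨n, hb⟩ := List.mem_iff_getElem?.1 hb
  obtain rfl := index_eq_of_isChain hR hp ha hb hab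
  exact Option.some.inj (ha.symm.trans hb)

namespace IsPathFamily

variable {R R' : α → α → Prop} {f : α → ι} {V : Set α} {P P' : Finset (List α)}

theorem eq_of_mem (h : IsPathFamily R V P) {p q : List α} (hp : p ∈ P) (hq : q ∈ P) {b : α}
    (hbp : b ∈ p) (hbq : b ∈ q) : p = q := by
  by_contra hne
  exact h.disjoint p hp q hq hne hbp hbq

theorem rel_of_follows (h : IsPathFamily R V P) {a b : α} (hab : Follows P a b) :
    R a b ∧ a ∈ V ∧ b ∈ V := by
  obtain ⟨p, hp, n, ha, hb⟩ := hab
  refine ⟨?_, h.subset p hp a (List.mem_of_getElem? ha), h.subset p hp b (List.mem_of_getElem? hb)⟩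
  rw [List.getElem?_eq_some_iff] at ha hb
  obtain ⟨hn, rfl⟩ := ha
  obtain ⟨hn', rfl⟩ := hb
  exact List.isChain_iff_getElem.1 (h.chain p hp) n hn'

variable (hR : ∀ a b, R a b → f a < f b) (hR' : ∀ a b, R' a b → f a < f b)
include hR

theorem follows_right_unique (h : IsPathFamily R V P) {a b b' : α} (hb : Follows P a b)
    (hb' : Follows P a b') : b = b' := by
  obtain ⟨p, hp, n, h1, h2⟩ := hb
  obtain ⟨q, hq, m, h3, h4⟩ := hb'
  obtain rfl := h.eq_of_mem hp hq (List.mem_of_getElem? h1) (List.mem_of_getElem? h3)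
  obtain rfl := index_eq_of_isChain hR (h.chain p hp) h1 h3 rfl
  exact Option.some.inj (h2.symm.trans h4)

theorem follows_left_unique (h : IsPathFamily R V P) {a a' b : α} (ha : Follows P a b)
    (ha' : Follows P a' b) : a = a' := by
  obtain ⟨p, hp, n, h1, h2⟩ := ha
  obtain ⟨q, hq, m, h3, h4⟩ := ha'
  obtain rfl := h.eq_of_mem hp hq (List.mem_of_getElem? h2) (List.mem_of_getElem? h4)
  have := index_eq_of_isChain hR (h.chain p hp) h2 h4 rfl
  obtain rfl : n = m := by omega
  exact Option.some.inj (h1.symm.trans h3)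

theorem exists_follows_left (h : IsPathFamily R V P) {p : List α} (hp : p ∈ P) {b d : α}
    (hb : b ∈ p) (hd : d ∈ p) (hdb : f d < f b) : ∃ a, Follows P a b ∧ f d ≤ f a := by
  obtain ⟨n, hb⟩ := List.mem_iff_getElem?.1 hb
  obtain ⟨m, hd⟩ := List.mem_iff_getElem?.1 hd
  have hmn := index_lt_of_isChain hR (h.chain p hp) hd hb hdb
  obtain ⟨n, rfl⟩ : ∃ n', n = n' + 1 := ⟨n - 1, by omega⟩
  have hn : n + 1 < p.length := (List.getElem?_eq_some_iff.1 hb).1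
  have ha : p[n]? = some p[n] := List.getElem?_eq_getElem _
  refine ⟨p[n], ⟨p, hp, n, ha, hb⟩, ?_⟩
  rcases (Nat.lt_succ_iff.1 hmn).lt_or_eq with hlt | rfl
  · exact (lt_of_isChain hR (h.chain p hp) hd ha hlt).le
  · rw [ha] at hd
    rw [Option.some.inj hd]

theorem exists_follows_right (h : IsPathFamily R V P) {p : List α} (hp : p ∈ P) {a d : α}
    (ha : a ∈ p) (hd : d ∈ p) (had : f a < f d) : ∃ b, Follows P a b ∧ f b ≤ f d := by
  obtain ⟨n, ha⟩ := List.mem_iff_getElem?.1 ha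
  obtain ⟨m, hd⟩ := List.mem_iff_getElem?.1 hd
  have hmn := index_lt_of_isChain hR (h.chain p hp) ha hd had
  have hm : m < p.length := (List.getElem?_eq_some_iff.1 hd).1
  have hb : p[n + 1]? = some (p[n + 1]'(by omega)) := List.getElem?_eq_getElem _
  refine ⟨p[n + 1]'(by omega), ⟨p, hp, n, ha, hb⟩, ?_⟩
  rcases (Nat.succ_le_of_lt hmn).lt_or_eq with hlt | rfl
  · exact (lt_of_isChain hR (h.chain p hp) hb hd hlt).le
  · rw [hb] at hd
    rw [← Option.some.inj hd]

include hR' in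
-- The head of a path follows nothing in either family, hence is a head in both; each further
-- element is then forced.
theorem subset_of_follows (h : IsPathFamily R V P) (h' : IsPathFamily R' V P')
    (hE : ∀ a b, Follows P a b ↔ Follows P' a b) : P ⊆ P' := by
  intro p hp
  obtain ⟨b, hb⟩ : ∃ b, p[0]? = some b :=
    ⟨_, List.getElem?_eq_getElem (List.length_pos_of_ne_nil (h.ne_nil p hp))⟩
  obtain ⟨q, hq, hbq⟩ := h'.covers b (h.subset p hp b (List.mem_of_getElem? hb))
  obtain ⟨m, hm⟩ := List.mem_iff_getElem?.1 hbq
  have hm0 : m = 0 := by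
    by_contra hm0
    obtain ⟨m, rfl⟩ : ∃ m', m = m' + 1 := ⟨m - 1, by omega⟩
    have hlt : m + 1 < q.length := (List.getElem?_eq_some_iff.1 hm).1
    have ha : q[m]? = some q[m] := List.getElem?_eq_getElem _
    obtain ⟨p', hp', n, -, h2⟩ := (hE _ _).2 ⟨q, hq, m, ha, hm⟩
    obtain rfl := h.eq_of_mem hp hp' (List.mem_of_getElem? hb) (List.mem_of_getElem? h2)
    have := index_eq_of_isChain hR (h.chain p hp) hb h2 rfl
    omega
  subst hm0
  have next : ∀ {R₁ R₂ : α → α → Prop} {P₁ P₂ : Finset (List α)} {p₁ p₂ : List α},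
      (∀ a b, R₂ a b → f a < f b) → IsPathFamily R₁ V P₁ → IsPathFamily R₂ V P₂ → p₁ ∈ P₁ →
      p₂ ∈ P₂ → (∀ a b, Follows P₁ a b → Follows P₂ a b) → ∀ n a b, p₁[n]? = some a →
      p₂[n]? = some a → p₁[n + 1]? = some b → p₂[n + 1]? = some b := by
    intro R₁ R₂ P₁ P₂ p₁ p₂ hR₂ h₁ h₂ hp₁ hp₂ hE n a b h1 h2 h3
    obtain ⟨p', hp', m, h4, h5⟩ := hE a b ⟨p₁, hp₁, n, h1, h3⟩
    obtain rfl := h₂.eq_of_mem hp₂ hp' (List.mem_of_getElem? h2) (List.mem_of_getElem? h4)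
    obtain rfl := index_eq_of_isChain hR₂ (h₂.chain p₂ hp₂) h2 h4 rfl
    exact h5
  have : p = q := by
    refine List.ext_getElem? fun n => ?_
    induction n with
    | zero => rw [hb, hm]
    | succ n ih =>
      rcases hpn : p[n]? with _ | a
      · have h1 := List.getElem?_eq_none_iff.1 hpn
        have h2 := List.getElem?_eq_none_iff.1 (ih.symm.trans hpn)
        rw [List.getElem?_eq_none (by omega), List.getElem?_eq_none (by omega)]
      · have hqn : q[n]? = some a := ih.symm.trans hpn
        rcases hpb : p[n + 1]? with _ | b
        · rcases hqb : q[n + 1]? with _ | b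
          · rfl
          · have := next hR h' h hq hp (fun a b => (hE a b).2) n a b hqn hpn hqb
            rw [hpb] at this
            cases this
        · exact (next hR' h h' hp hq (fun a b => (hE a b).1) n a b hpn hqn hpb).symm
  exact this ▸ hq

include hR' in
/-- A family of paths is determined by the pairs of consecutive elements. -/
theorem ext_follows (h : IsPathFamily R V P) (h' : IsPathFamily R' V P')
    (hE : ∀ a b, Follows P a b ↔ Follows P' a b) : P = P' :=
  (h.subset_of_follows hR hR' h' hE).antisymm
    (h'.subset_of_follows hR' hR h fun a b => (hE a b).symm)

open Classical in
/-- There are as many paths as elements which do not follow another one. -/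
theorem card_starts {V : Finset α} (h : IsPathFamily R V P) :
    (V.filter fun b => ∀ a, ¬ Follows P a b).card = P.card := by
  symm
  refine Finset.card_bij (fun p hp => p.head (h.ne_nil p hp)) ?_ ?_ ?_
  · intro p hp
    have h0 : p[0]? = some (p.head (h.ne_nil p hp)) := by
      rw [← List.head?_eq_getElem?, List.head?_eq_some_head]
    refine Finset.mem_filter.2 ⟨h.subset p hp _ (List.head_mem _), fun a ha => ?_⟩
    obtain ⟨q, hq, n, -, h2⟩ := ha
    obtain rfl := h.eq_of_mem hp hq (List.mem_of_getElem? h0) (List.mem_of_getElem? h2)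
    have := index_eq_of_isChain hR (h.chain p hp) h0 h2 rfl
    omega
  · intro p hp q hq hpq
    have hq' : q.head (h.ne_nil q hq) ∈ p := by
      rw [← show p.head _ = q.head _ from hpq]
      exact List.head_mem _
    exact h.eq_of_mem hp hq hq' (List.head_mem _)
  · intro b hb
    obtain ⟨hbV, hb⟩ := Finset.mem_filter.1 hb
    obtain ⟨p, hp, hbp⟩ := h.covers b hbV
    refine ⟨p, hp, ?_⟩
    obtain ⟨n, hn⟩ := List.mem_iff_getElem?.1 hbp
    rcases n with _ | n
    · rw [← List.head?_eq_getElem?, List.head?_eq_some_head (h.ne_nil p hp)] at hn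
      exact Option.some.inj hn
    · have hlt : n + 1 < p.length := (List.getElem?_eq_some_iff.1 hn).1
      exact absurd ⟨p, hp, n, List.getElem?_eq_getElem _, hn⟩ (hb p[n])

end IsPathFamily

open Classical in
/-- A finite set is covered by the paths of a relation with unique successors. -/
theorem exists_isPathFamily {R : α → α → Prop} {f : α → ι} (hR : ∀ a b, R a b → f a < f b)
    (hsucc : ∀ a b b', R a b → R a b' → b = b') (V : Finset α) :
    ∃ P, IsPathFamily R V P ∧ P.card = (V.filter fun b => ∀ a ∈ V, ¬ R a b).card := by
  induction V using Finset.induction_on_max_value f with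
  | empty => exact ⟨∅, ⟨by simp, by simp, by simp, by simp, by simp⟩, by simp⟩
  | insert b V hbV hmax ih =>
    obtain ⟨P, hP, hcard⟩ := ih
    have hRb : ∀ a ∈ insert b V, ¬ R b a := by
      intro a ha hba
      rcases Finset.mem_insert.1 ha with rfl | ha
      · exact lt_irrefl _ (hR _ _ hba)
      · exact absurd (hmax a ha) (by simpa using hR _ _ hba)
    have hbP : ∀ p ∈ P, b ∉ p := fun p hp hb => hbV (hP.subset p hp b hb)
    have hold : (V.filter fun d => ∀ a ∈ insert b V, ¬ R a d) =
        V.filter fun d => ∀ a ∈ V, ¬ R a d := by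
      refine Finset.filter_congr fun d hd => ?_
      simp [hRb d (Finset.mem_insert_of_mem hd)]
    by_cases hb : ∃ a ∈ V, R a b
    · obtain ⟨a, haV, hab⟩ := hb
      obtain ⟨p, hp, hap⟩ := hP.covers a haV
      -- By unique successors, an element following `a` would be `b`, which is not yet covered; so
      -- `a` is last on its path.
      have hlast : ∀ x ∈ p.getLast?, R x b := by
        intro x hx
        obtain ⟨n, hn⟩ := List.mem_iff_getElem?.1 hap
        have hlt : n < p.length := (List.getElem?_eq_some_iff.1 hn).1
        rcases (Nat.succ_le_of_lt hlt).lt_or_eq with h | h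
        · have hfol : Follows P a p[n + 1] := ⟨p, hp, n, hn, List.getElem?_eq_getElem _⟩
          have h1 := hP.rel_of_follows hfol
          rw [hsucc _ _ _ h1.1 hab] at h1
          exact absurd h1.2.2 hbV
        · rw [List.getLast?_eq_getElem?] at hx
          rw [show p.length - 1 = n by omega, hn] at hx
          rw [← Option.some.inj hx]
          exact hab
      have hnotin : p ++ [b] ∉ P.erase p := fun h =>
        hbP _ (Finset.mem_of_mem_erase h) (by simp)
      refine ⟨insert (p ++ [b]) (P.erase p), ⟨?_, ?_, ?_, ?_, ?_⟩, ?_⟩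
      · intro q hq
        rcases Finset.mem_insert.1 hq with rfl | hq
        · simp
        · exact hP.ne_nil q (Finset.mem_of_mem_erase hq)
      · intro q hq
        rcases Finset.mem_insert.1 hq with rfl | hq
        · exact List.IsChain.append (hP.chain p hp) (by simp) (by simpa using hlast)
        · exact hP.chain q (Finset.mem_of_mem_erase hq)
      · have key : ∀ q ∈ P.erase p, (p ++ [b]).Disjoint q := by
          intro q hq x hx hxq
          rcases List.mem_append.1 hx with hx | hx
          · exact hP.disjoint p hp q (Finset.mem_of_mem_erase hq)
              (Finset.ne_of_mem_erase hq).symm hx hxq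
          · rw [List.mem_singleton.1 hx] at hxq
            exact hbP q (Finset.mem_of_mem_erase hq) hxq
        intro q hq q' hq' hne
        rcases Finset.mem_insert.1 hq with rfl | hq <;>
          rcases Finset.mem_insert.1 hq' with rfl | hq'
        · exact absurd rfl hne
        · exact key q' hq'
        · exact (key q hq).symm
        · exact hP.disjoint q (Finset.mem_of_mem_erase hq) q' (Finset.mem_of_mem_erase hq') hne
      · intro q hq x hx
        rcases Finset.mem_insert.1 hq with rfl | hq
        · rcases List.mem_append.1 hx with hx | hx
          · exact Finset.mem_insert_of_mem (hP.subset p hp x hx)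
          · rw [List.mem_singleton.1 hx]
            exact Finset.mem_insert_self _ _
        · exact Finset.mem_insert_of_mem (hP.subset q (Finset.mem_of_mem_erase hq) x hx)
      · intro x hx
        rcases Finset.mem_insert.1 hx with rfl | hx
        · exact ⟨_, Finset.mem_insert_self _ _, by simp⟩
        · obtain ⟨q, hq, hxq⟩ := hP.covers x hx
          by_cases hqp : q = p
          · exact ⟨_, Finset.mem_insert_self _ _, by simp [← hqp, hxq]⟩
          · exact ⟨q, Finset.mem_insert_of_mem (Finset.mem_erase.2 ⟨hqp, hq⟩), hxq⟩
      · rw [Finset.card_insert_of_notMem hnotin, Finset.card_erase_add_one hp, hcard,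
          Finset.filter_insert, if_neg, hold]
        push Not
        exact ⟨a, Finset.mem_insert_of_mem haV, hab⟩
    · have hnotin : [b] ∉ P := fun h => hbP _ h (by simp)
      refine ⟨insert [b] P, ⟨?_, ?_, ?_, ?_, ?_⟩, ?_⟩
      · intro q hq
        rcases Finset.mem_insert.1 hq with rfl | hq
        · simp
        · exact hP.ne_nil q hq
      · intro q hq
        rcases Finset.mem_insert.1 hq with rfl | hq
        · simp
        · exact hP.chain q hq
      · intro q hq q' hq' hne
        rcases Finset.mem_insert.1 hq with rfl | hq <;>
          rcases Finset.mem_insert.1 hq' with rfl | hq'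
        · exact absurd rfl hne
        · simpa using hbP q' hq'
        · simpa using hbP q hq
        · exact hP.disjoint q hq q' hq' hne
      · intro q hq x hx
        rcases Finset.mem_insert.1 hq with rfl | hq
        · rw [List.mem_singleton.1 hx]
          exact Finset.mem_insert_self _ _
        · exact Finset.mem_insert_of_mem (hP.subset q hq x hx)
      · intro x hx
        rcases Finset.mem_insert.1 hx with rfl | hx
        · exact ⟨_, Finset.mem_insert_self _ _, by simp⟩
        · obtain ⟨q, hq, hxq⟩ := hP.covers x hx
          exact ⟨q, Finset.mem_insert_of_mem hq, hxq⟩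
      · push Not at hb
        rw [Finset.card_insert_of_notMem hnotin, hcard, Finset.filter_insert, if_pos, hold,
          Finset.card_insert_of_notMem]
        · simp [hbV]
        · intro a ha
          rcases Finset.mem_insert.1 ha with rfl | ha
          exacts [hRb _ (Finset.mem_insert_self _ _), hb a ha]

/-- Of two bijections from `S` to `T`, given by their graphs, one cannot precede the other. -/
theorem rel_of_weight_le {E E' : α → α → Prop} {S T : Finset α} (φ : α → ℕ)
    (hT : ∀ b ∈ T, ∃ a ∈ S, E a b) (hS : ∀ a ∈ S, ∃ b ∈ T, E a b)
    (hl : ∀ a a' b, E a b → E a' b → a = a') (hr : ∀ a b b', E a b → E a b' → b = b')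
    (hT' : ∀ b ∈ T, ∃ a ∈ S, E' a b) (hS' : ∀ a ∈ S, ∃ b ∈ T, E' a b)
    (hl' : ∀ a a' b, E' a b → E' a' b → a = a') (hr' : ∀ a b b', E' a b → E' a b' → b = b')
    (hlt : ∀ a a' b, E a b → E' a' b → a' = a ∨ φ a' < φ a) {a b : α} (hb : b ∈ T)
    (hab : E a b) : E' a b := by
  -- The predecessors of the elements of `T` run through `S` once each, so their total weight does
  -- not depend on the bijection.
  have sum_eq : ∀ {E : α → α → Prop}, (∀ a ∈ S, ∃ b ∈ T, E a b) →
      (∀ a a' b, E a b → E a' b → a = a') → (∀ a b b', E a b → E a b' → b = b') →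
      ∀ π : ∀ b ∈ T, α, (∀ b hb, π b hb ∈ S) → (∀ b hb, E (π b hb) b) →
      ∑ b ∈ T.attach, φ (π b.1 b.2) = ∑ a ∈ S, φ a := by
    intro E hS hl hr π hπ hπE
    refine Finset.sum_bij (fun b _ => π b.1 b.2) (fun b _ => hπ _ _) ?_ ?_ (fun _ _ => rfl)
    · intro b _ b' _ hbb
      exact Subtype.ext (hr _ _ _ (hπE b.1 b.2) (hbb ▸ hπE b'.1 b'.2))
    · intro a ha
      obtain ⟨b, hb, hab⟩ := hS a ha
      exact ⟨⟨b, hb⟩, Finset.mem_attach _ _, hl _ _ _ (hπE b hb) hab⟩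
  choose π hπ hπE using hT
  choose π' hπ' hπE' using hT'
  have hle : ∀ b ∈ T.attach, φ (π' b.1 b.2) ≤ φ (π b.1 b.2) := by
    intro b _
    rcases hlt _ _ _ (hπE b.1 b.2) (hπE' b.1 b.2) with h | h
    exacts [(congrArg φ h).le, h.le]
  have heq := (Finset.sum_eq_sum_iff_of_le hle).1
    ((sum_eq hS' hl' hr' π' hπ' hπE').trans (sum_eq hS hl hr π hπ hπE).symm) ⟨b, hb⟩
    (Finset.mem_attach _ _)
  have hE' := hπE' b hb
  rcases hlt _ _ _ hab hE' with h | h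
  · exact h ▸ hE'
  · rw [hl _ _ _ hab (hπE b hb)] at h
    exact absurd heq h.ne

end Families

/-! ### Path families in the diagram -/

theorem finite_boxes (c : Fin k → ℕ) (i : ℕ) (X : Set (Fin k)) :
    {b : Box k | IsBox c b ∧ b.row ≤ i ∧ b.col ∈ X}.Finite := by
  refine ((Set.toFinite (Set.univ ×ˢ Set.Iic i)).image
    fun x : Fin k × ℕ => (⟨x.1, x.2⟩ : Box k)).subset ?_
  rintro ⟨D, r⟩ ⟨-, hr, -⟩
  exact ⟨(D, r), ⟨trivial, hr⟩, rfl⟩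

/-- The boxes in the first `i` rows of the columns in `X`. -/
noncomputable def boxes (c : Fin k → ℕ) (i : ℕ) (X : Set (Fin k)) : Finset (Box k) :=
  (finite_boxes c i X).toFinset

@[simp] theorem mem_boxes {c : Fin k → ℕ} {i : ℕ} {X : Set (Fin k)} {b : Box k} :
    b ∈ boxes c i X ↔ IsBox c b ∧ b.row ≤ i ∧ b.col ∈ X := by
  simp [boxes]

/-- The relation given by a set of lines. -/
def Joined (L : Set (Line k)) (a b : Box k) : Prop :=
  (⟨a, b⟩ : Line k) ∈ L

/-- A path meets a column at most once, so the `i` boxes lie on distinct paths; if there are only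
`i` paths, none is left over. -/
theorem passes_column {i : ℕ} {L : Set (Line k)} (hL : ∀ a b, Joined L a b → a.col < b.col)
    {P : Finset (List (Box k))} (hP : ∀ p ∈ P, p.IsChain (Joined L)) {C : Fin k}
    (hC : ∀ r, 1 ≤ r → r ≤ i → ∃ p ∈ P, (⟨C, r⟩ : Box k) ∈ p) :
    i ≤ P.card ∧ (P.card = i → ∀ p ∈ P, ∃ r, 1 ≤ r ∧ r ≤ i ∧ (⟨C, r⟩ : Box k) ∈ p) := by
  classical
  have hC' : ∀ r ∈ Finset.Icc 1 i, ∃ p ∈ P, (⟨C, r⟩ : Box k) ∈ p := fun r hr =>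
    hC r (Finset.mem_Icc.1 hr).1 (Finset.mem_Icc.1 hr).2
  choose! p hp hCp using hC'
  have hinj : Set.InjOn p (Finset.Icc 1 i) := by
    intro r hr s hs hrs
    have h1 := hCp r hr
    rw [hrs] at h1
    have := eq_of_isChain_of_mem hL (hP _ (hp s hs)) h1 (hCp s hs) rfl
    exact congrArg Box.row this
  have himage : (Finset.Icc 1 i).image p ⊆ P := Finset.image_subset_iff.2 hp
  have hcard : ((Finset.Icc 1 i).image p).card = i := by
    rw [Finset.card_image_of_injOn hinj, Nat.card_Icc, Nat.add_sub_cancel]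
  refine ⟨hcard ▸ Finset.card_le_card himage, fun h q hq => ?_⟩
  rw [← Finset.eq_of_subset_of_card_le himage (by omega)] at hq
  obtain ⟨r, hr, rfl⟩ := Finset.mem_image.1 hq
  exact ⟨r, (Finset.mem_Icc.1 hr).1, (Finset.mem_Icc.1 hr).2, hCp r hr⟩

/-! ### Existence and uniqueness of the decompositions -/

namespace Regular

variable {c : Fin k → ℕ} {i : ℕ} {S : Labelling k} (h : Regular c i S)
include h

theorem joined_col_lt {L : Set (Line k)} (hL : L ⊆ S.active ∪ S.gated) (a b : Box k)
    (hab : Joined L a b) : a.col < b.col :=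
  h.col_lt _ (hL hab)

theorem joined_row_iff {L : Set (Line k)} (hL : L ⊆ S.active ∪ S.gated) {a b : Box k}
    (hab : Joined L a b) : a.row ≤ i ↔ b.row ≤ i := by
  rcases h.rows _ (hL hab) with h' | h'
  · exact ⟨fun _ => h'.2, fun _ => h'.1⟩
  · have := h'.1.2.2.1
    simp only at this
    rw [this]

section Column

variable {L : Set (Line k)} (hL : L ⊆ S.active ∪ S.gated) {X : Set (Fin k)}
  {P : Finset (List (Box k))} {C : Fin k} (hCX : C ∈ X) (hC : i ≤ c C)
include hL hCX hC

theorem exists_mem_column (hP : IsDisjointUnion c L i X P) {p : List (Box k)} (hp : p ∈ P) :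
    ∃ r, 1 ≤ r ∧ r ≤ i ∧ (⟨C, r⟩ : Box k) ∈ p :=
  (passes_column (h.joined_col_lt hL) (fun p hp => (hP.composite p hp).2.2)
    fun r hr hri => hP.covers ⟨C, r⟩ ⟨hr, hri.trans hC⟩ hri hCX).2 hP.card_eq p hp

/-- `IsDisjointUnion` does not itself confine the paths to the first `i` rows. They are confined
because each meets column `C` there and no line crosses row `i`. -/
theorem isPathFamily (hP : IsDisjointUnion c L i X P) :
    IsPathFamily (Joined L) (boxes c i X : Set (Box k)) P where
  ne_nil p hp := (hP.composite p hp).1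
  chain p hp := (hP.composite p hp).2.2
  disjoint := hP.disjoint
  subset p hp b hb := by
    obtain ⟨r, -, hri, hr⟩ := h.exists_mem_column hL hCX hC hP hp
    refine mem_boxes.2 ⟨(hP.composite p hp).2.1 b hb, ?_, hP.within p hp b hb⟩
    have h1 : p.IsChain fun a b : Box k => a.row ≤ i ↔ b.row ≤ i :=
      (hP.composite p hp).2.2.imp fun a b => h.joined_row_iff hL
    have : IsTrans (Box k) fun a b : Box k => a.row ≤ i ↔ b.row ≤ i :=
      ⟨fun _ _ _ => Iff.trans⟩
    have : Std.Symm fun a b : Box k => a.row ≤ i ↔ b.row ≤ i := ⟨fun _ _ => Iff.symm⟩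
    exact (List.Pairwise.forall_of_forall (R := fun a b : Box k => a.row ≤ i ↔ b.row ≤ i)
      (fun _ _ => Iff.rfl) (List.isChain_iff_pairwise.1 h1) hr hb).1 hri
  covers b hb := by
    obtain ⟨hb, hbi, hbX⟩ := mem_boxes.1 hb
    exact hP.covers b hb hbi hbX

end Column

theorem active_ext_left (a b b' : Box k) (hb : Joined S.active a b) (hb' : Joined S.active a b') :
    b = b' :=
  congrArg Line.right (h.ext_left _ hb _ hb' rfl)

theorem active_ext_right (a a' b : Box k) (ha : Joined S.active a b)
    (ha' : Joined S.active a' b) : a = a' :=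
  congrArg Line.left (h.ext_right _ ha _ ha' rfl)

open Classical in
-- Column `C` forces at least `i` chains, so an upper bound on the number of starts suffices.
theorem exists_isDisjointUnion {X : Set (Fin k)} {C : Fin k} (hCX : C ∈ X) (hC : i ≤ c C)
    (hstart : ((boxes c i X).filter fun b => ∀ a ∈ boxes c i X, ¬ Joined S.active a b).card ≤ i) :
    ((boxes c i X).filter fun b => ∀ a ∈ boxes c i X, ¬ Joined S.active a b).card = i ∧
      ∃ P, IsDisjointUnion c S.active i X P := by
  have hcol := h.joined_col_lt (L := S.active) Set.subset_union_left
  obtain ⟨P, hP, hcard⟩ := exists_isPathFamily hcol h.active_ext_left (boxes c i X)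
  have hle := (passes_column (i := i) (C := C) hcol hP.chain fun r hr hri =>
    hP.covers ⟨C, r⟩ (mem_boxes.2 ⟨⟨hr, hri.trans hC⟩, hri, hCX⟩)).1
  refine ⟨by omega, P, by omega, fun p hp => ⟨hP.ne_nil p hp, fun b hb => ?_, hP.chain p hp⟩,
    hP.disjoint, fun p hp b hb => ?_, fun b hb hbi hbX => ?_⟩
  · exact (mem_boxes.1 (hP.subset p hp b hb)).1
  · exact (mem_boxes.1 (hP.subset p hp b hb)).2.2
  · exact hP.covers b (mem_boxes.2 ⟨hb, hbi, hbX⟩)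

omit h in
-- The label is the row for the first kind and the row plus one for the second. Label `r` is taken
-- by the leftmost column of height at least `r` only if at most one column of height `r - 1`
-- precedes it, and by the second column of height `r - 1` only if no taller one precedes it; these
-- exclude each other.
theorem isStart_ext {b d : Box k} (hb : IsBox c b) (hd : IsBox c d) (hbs : IsStart c i b)
    (hds : IsStart c i d)
    (hlabel : (if (∀ E < b.col, c E < b.row) ∧
        ∀ E F, E < F → F < b.col → c E + 1 = b.row → c F + 1 ≠ b.row then b.row else b.row + 1) =
      if (∀ E < d.col, c E < d.row) ∧
        ∀ E F, E < F → F < d.col → c E + 1 = d.row → c F + 1 ≠ d.row then d.row else d.row + 1) :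
    b = d := by
  have first_second : ∀ {b d : Box k}, IsBox c b → IsBox c d →
      (∀ E < b.col, c E < b.row) →
      (∀ E F, E < F → F < b.col → c E + 1 = b.row → c F + 1 ≠ b.row) →
      c d.col = d.row → (∃ E < d.col, c E = d.row) → (∀ E < d.col, c E ≤ d.row) →
      b.row = d.row + 1 → False := by
    intro b d hb hd h1 h2 h3 ⟨E, hE, hcE⟩ h4 hrow
    have hb2 := hb.2
    rcases lt_trichotomy b.col d.col with hlt | heq | hlt
    · have := h4 _ hlt
      omega
    · rw [heq] at hb2
      omega
    · exact h2 E d.col hE hlt (by omega) (by omega)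
  have hb2 := hb.2
  have hd2 := hd.2
  split_ifs at hlabel with h1 h2 h2
  · refine Box.ext (le_antisymm ?_ ?_) hlabel
    · by_contra! hlt
      have := h1.1 _ hlt
      omega
    · by_contra! hlt
      have := h2.1 _ hlt
      omega
  · have hds := hds.resolve_left h2
    exact (first_second hb hd h1.1 h1.2 hds.2.1 hds.2.2.1 hds.2.2.2.1 hlabel).elim
  · have hbs := hbs.resolve_left h1
    exact (first_second hd hb h2.1 h2.2 hbs.2.1 hbs.2.2.1 hbs.2.2.2.1 hlabel.symm).elim
  · have hbs := hbs.resolve_left h1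
    have hds := hds.resolve_left h2
    have hrow : b.row = d.row := by omega
    obtain ⟨-, hb1, ⟨E, hE, hcE⟩, -, hb3⟩ := hbs
    obtain ⟨-, hd1, ⟨F, hF, hcF⟩, -, hd3⟩ := hds
    refine Box.ext (le_antisymm ?_ ?_) hrow
    · by_contra! hlt
      exact hb3 F d.col hF hlt (by omega) (by omega)
    · by_contra! hlt
      exact hd3 E b.col hE hlt (by omega) (by omega)

open Classical in
theorem card_starts_le (hC : ∃ C, i ≤ c C) :
    ((boxes c i Set.univ).filter fun b => ∀ a ∈ boxes c i Set.univ,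
      ¬ Joined S.active a b).card ≤ i := by
  have hstart : ∀ b ∈ (boxes c i Set.univ).filter fun b => ∀ a ∈ boxes c i Set.univ,
      ¬ Joined S.active a b, IsBox c b ∧ b.row ≤ i ∧ IsStart c i b := by
    intro b hb
    obtain ⟨hb, hno⟩ := Finset.mem_filter.1 hb
    obtain ⟨hb, hbi, -⟩ := mem_boxes.1 hb
    refine ⟨hb, hbi, h.isStart b hb hbi fun x hx hxb => ?_⟩
    subst hxb
    exact hno x.left (mem_boxes.2 ⟨h.left_box x (Or.inl hx),
      (h.joined_row_iff Set.subset_union_left hx).2 hbi, trivial⟩) hx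
  have := Finset.card_le_card_of_injOn (t := Finset.Icc 1 i) (fun b : Box k =>
    if (∀ E < b.col, c E < b.row) ∧
      ∀ E F, E < F → F < b.col → c E + 1 = b.row → c F + 1 ≠ b.row then b.row else b.row + 1)
    (fun b hb => ?_) (fun b hb d hd => isStart_ext (hstart b hb).1 (hstart d hd).1
      (hstart b hb).2.2 (hstart d hd).2.2)
  · simpa using this
  · obtain ⟨hb, hbi, hbs⟩ := hstart b hb
    have := hb.1
    rw [Finset.coe_Icc, Set.mem_Icc]
    dsimp only
    split_ifs with h1
    · exact ⟨this, hbi⟩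
    · have := (hbs.resolve_left h1).1
      omega

/-- The lines which have not been gated decompose in one way only. -/
theorem existsUnique_active (hC : ∃ C, i ≤ c C) :
    ∃! P, IsDisjointUnion c S.active i Set.univ P := by
  classical
  obtain ⟨C, hC'⟩ := hC
  have hL : S.active ⊆ S.active ∪ S.gated := Set.subset_union_left
  have hcol := h.joined_col_lt hL
  obtain ⟨hcard, P, hP⟩ :=
    h.exists_isDisjointUnion (Set.mem_univ C) hC' (h.card_starts_le ⟨C, hC'⟩)
  -- A family has `i` heads, as many as there are boxes without incoming active line. Every other
  -- box therefore follows one, and by `active_ext_right` through its only active line.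
  have key : ∀ Q, IsDisjointUnion c S.active i Set.univ Q → ∀ a b, Follows Q a b ↔
      Joined S.active a b ∧ a ∈ boxes c i Set.univ ∧ b ∈ boxes c i Set.univ := by
    intro Q hQ a b
    have hfam := h.isPathFamily hL (Set.mem_univ C) hC' hQ
    refine ⟨fun hab => hfam.rel_of_follows hab, fun ⟨hab, ha, hb⟩ => ?_⟩
    have hheads := hfam.card_starts hcol
    rw [hQ.card_eq] at hheads
    have hsub : ((boxes c i Set.univ).filter fun b => ∀ a ∈ boxes c i Set.univ,
        ¬ Joined S.active a b) ⊆ (boxes c i Set.univ).filter fun b => ∀ a, ¬ Follows Q a b := by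
      intro b hb
      obtain ⟨hbV, hb⟩ := Finset.mem_filter.1 hb
      refine Finset.mem_filter.2 ⟨hbV, fun a hab => ?_⟩
      have := hfam.rel_of_follows hab
      exact hb a this.2.1 this.1
    have heq := Finset.eq_of_subset_of_card_le hsub (by omega)
    have hb' : b ∉ (boxes c i Set.univ).filter fun b => ∀ a, ¬ Follows Q a b := by
      rw [← heq, Finset.mem_filter]
      exact fun h' => h'.2 a ha hab
    have : ∃ a, Follows Q a b := by
      by_contra! hno
      exact hb' (Finset.mem_filter.2 ⟨hb, hno⟩)
    obtain ⟨a', ha'⟩ := this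
    rwa [h.active_ext_right a a' b hab (hfam.rel_of_follows ha').1]
  refine ⟨P, hP, fun Q hQ => ?_⟩
  exact (h.isPathFamily hL (Set.mem_univ C) hC' hQ).ext_follows hcol hcol
    (h.isPathFamily hL (Set.mem_univ C) hC' hP) fun a b => by rw [key Q hQ, key P hP]

/-- Every path of the global decomposition meets column `C`, so each box of the interval outside `C`
has its predecessor in the interval; at most the `i` boxes of `C` are starts. -/
theorem exists_active_Icc {C C' : Fin k} (hCC : C ≤ C') (hC : i ≤ c C) :
    ∃ P, IsDisjointUnion c S.active i (Set.Icc C C') P := by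
  classical
  have hL : S.active ⊆ S.active ∪ S.gated := Set.subset_union_left
  have hcol := h.joined_col_lt hL
  obtain ⟨P, hP, -⟩ := h.existsUnique_active ⟨C, hC⟩
  have hfam := h.isPathFamily hL (Set.mem_univ C) hC hP
  refine (h.exists_isDisjointUnion (Set.left_mem_Icc.2 hCC) hC ?_).2
  have hcolumn : ∀ b ∈ (boxes c i (Set.Icc C C')).filter fun b => ∀ a ∈ boxes c i (Set.Icc C C'),
      ¬ Joined S.active a b, b.col = C ∧ b.row ∈ Finset.Icc 1 i := by
    intro b hb
    obtain ⟨hb, hno⟩ := Finset.mem_filter.1 hb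
    obtain ⟨hbox, hbi, hbX⟩ := mem_boxes.1 hb
    refine ⟨?_, Finset.mem_Icc.2 ⟨hbox.1, hbi⟩⟩
    by_contra hne
    obtain ⟨p, hp, hbp⟩ := hP.covers b hbox hbi trivial
    obtain ⟨r, -, -, hr⟩ := h.exists_mem_column hL (Set.mem_univ C) hC hP hp
    obtain ⟨a, hab, hCa⟩ := hfam.exists_follows_left hcol hp hbp hr
      (lt_of_le_of_ne hbX.1 (Ne.symm hne))
    obtain ⟨hrel, ha, -⟩ := hfam.rel_of_follows hab
    obtain ⟨habox, hai, -⟩ := mem_boxes.1 ha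
    exact hno a (mem_boxes.2 ⟨habox, hai, hCa, ((hcol a b hrel).trans_le hbX.2).le⟩) hrel
  have := Finset.card_le_card_of_injOn (t := Finset.Icc 1 i) (fun b : Box k => b.row)
    (fun b hb => (hcolumn b hb).2) (fun b hb d hd hbd =>
      Box.ext ((hcolumn b hb).1.trans (hcolumn d hd).1.symm) hbd)
  simpa using this

omit h in
-- As `i - row` is less than the factor `i + 1`, the weight is lexicographic: column first, then
-- upwards.
theorem weight_lt {a b : Box k} (hb : b.row ≤ i)
    (hab : a.col < b.col ∨ a.col = b.col ∧ b.row < a.row) (ha : a.row ≤ i) :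
    (a.col : ℕ) * (i + 1) + (i - a.row) < b.col * (i + 1) + (i - b.row) := by
  rcases hab with hab | ⟨hab, hrow⟩
  · have h1 : ((a.col : ℕ) + 1) * (i + 1) ≤ b.col * (i + 1) := Nat.mul_le_mul_right _ hab
    rw [Nat.add_mul] at h1
    omega
  · rw [hab]
    omega

/-- All the lines decompose in one way only between two columns of height at least `i`. -/
theorem existsUnique_Icc {C C' : Fin k} (hCC : C ≤ C') (hC : i ≤ c C) (hC' : i ≤ c C') :
    ∃! P, IsDisjointUnion c (S.active ∪ S.gated) i (Set.Icc C C') P := by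
  classical
  have hcol := h.joined_col_lt (L := S.active ∪ S.gated) subset_rfl
  have hcol' := h.joined_col_lt (L := S.active) Set.subset_union_left
  have hCX : C ∈ Set.Icc C C' := Set.left_mem_Icc.2 hCC
  have hCX' : C' ∈ Set.Icc C C' := Set.right_mem_Icc.2 hCC
  obtain ⟨P, hP⟩ := h.exists_active_Icc hCC hC
  have hPfam := h.isPathFamily Set.subset_union_left hCX hC hP
  -- All paths meet both `C` and `C'`, so every box right of `C` has a predecessor and every box
  -- left of `C'` a successor.
  have hfull : ∀ {L : Set (Line k)}, L ⊆ S.active ∪ S.gated → ∀ {Q : Finset (List (Box k))},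
      IsDisjointUnion c L i (Set.Icc C C') Q →
      (∀ b ∈ (boxes c i (Set.Icc C C')).filter fun b => C < b.col,
        ∃ a ∈ (boxes c i (Set.Icc C C')).filter fun a => a.col < C', Follows Q a b) ∧
      (∀ a ∈ (boxes c i (Set.Icc C C')).filter fun a => a.col < C',
        ∃ b ∈ (boxes c i (Set.Icc C C')).filter fun b => C < b.col, Follows Q a b) := by
    intro L hL Q hQ
    have hfam := h.isPathFamily hL hCX hC hQ
    have hcolL := h.joined_col_lt hL
    refine ⟨fun b hb => ?_, fun a ha => ?_⟩
    · obtain ⟨hb, hCb⟩ := Finset.mem_filter.1 hb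
      obtain ⟨p, hp, hbp⟩ := hfam.covers b hb
      obtain ⟨r, -, -, hr⟩ := h.exists_mem_column hL hCX hC hQ hp
      obtain ⟨a, hab, -⟩ := hfam.exists_follows_left hcolL hp hbp hr hCb
      obtain ⟨hrel, ha, -⟩ := hfam.rel_of_follows hab
      exact ⟨a, Finset.mem_filter.2 ⟨ha, (hcolL a b hrel).trans_le (mem_boxes.1 hb).2.2.2⟩, hab⟩
    · obtain ⟨ha, haC⟩ := Finset.mem_filter.1 ha
      obtain ⟨p, hp, hap⟩ := hfam.covers a ha
      obtain ⟨r, -, -, hr⟩ := h.exists_mem_column hL hCX' hC' hQ hp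
      obtain ⟨b, hab, -⟩ := hfam.exists_follows_right hcolL hp hap hr haC
      obtain ⟨hrel, -, hb⟩ := hfam.rel_of_follows hab
      exact ⟨b, Finset.mem_filter.2 ⟨hb, (mem_boxes.1 ha).2.2.1.trans_lt (hcolL a b hrel)⟩, hab⟩
  refine ⟨P, ⟨hP.card_eq, fun p hp => ?_, hP.disjoint, hP.within, hP.covers⟩, fun Q hQ => ?_⟩
  · obtain ⟨h1, h2, h3⟩ := hP.composite p hp
    exact ⟨h1, h2, h3.imp fun a b => Or.inl⟩
  have hQfam := h.isPathFamily subset_rfl hCX hC hQ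
  have hQP : ∀ a b, Follows Q a b → Follows P a b := by
    intro a b hab
    obtain ⟨hrel, ha, hb⟩ := hQfam.rel_of_follows hab
    refine rel_of_weight_le (fun d : Box k => (d.col : ℕ) * (i + 1) + (i - d.row))
      (hfull subset_rfl hQ).1 (hfull subset_rfl hQ).2
      (fun _ _ _ => hQfam.follows_left_unique hcol) (fun _ _ _ => hQfam.follows_right_unique hcol)
      (hfull Set.subset_union_left hP).1 (hfull Set.subset_union_left hP).2
      (fun _ _ _ => hPfam.follows_left_unique hcol')
      (fun _ _ _ => hPfam.follows_right_unique hcol') (fun d d' e hd hd' => ?_)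
      (Finset.mem_filter.2 ⟨hb, (mem_boxes.1 ha).2.2.1.trans_lt (hcol a b hrel)⟩) hab
    obtain ⟨hde, hdV, -⟩ := hQfam.rel_of_follows hd
    obtain ⟨hde', hdV', -⟩ := hPfam.rel_of_follows hd'
    rcases hde with hde | hde
    · exact Or.inl (h.active_ext_right d' d e hde' hde)
    · exact Or.inr (weight_lt (mem_boxes.1 hdV).2.1 (h.gated_lt _ hde _ hde' rfl)
        (mem_boxes.1 hdV').2.1)
  refine hQfam.ext_follows hcol hcol' hPfam fun a b => ⟨hQP a b, fun hab => ?_⟩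
  obtain ⟨hrel, ha, hb⟩ := hPfam.rel_of_follows hab
  obtain ⟨a', -, ha'⟩ := (hfull subset_rfl hQ).1 b
    (Finset.mem_filter.2 ⟨hb, (mem_boxes.1 ha).2.2.1.trans_lt (hcol' a b hrel)⟩)
  rwa [hPfam.follows_left_unique hcol' hab (hQP a' b ha')]

end Regular

end MaximalGating

theorem proposition5p4p11 {k : ℕ} (c : Fin k → ℕ) (hc : ∀ j, 1 ≤ c j) (i : ℕ) (hi : 1 ≤ i) :
    (∀ C C' : Fin k, C ≤ C' → i ≤ c C → i ≤ c C' →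
      ∃! P : Finset (List (MaximalGating.Box k)),
        MaximalGating.IsDisjointUnion c (MaximalGating.stage c i).lines i (Set.Icc C C') P) ∧
    ((∃ C, i ≤ c C) →
      ∃! P : Finset (List (MaximalGating.Box k)),
        MaximalGating.IsDisjointUnion c
          ((MaximalGating.stage c i).one ∪ (MaximalGating.stage c i).ungated) i Set.univ P) ∧
    MaximalGating.UpGoingLinkage (MaximalGating.stage c i) i ∧
    MaximalGating.StrictNonOverlapping (MaximalGating.stage c i) i ∧
    MaximalGating.Adjacency c (MaximalGating.stage c i) i := by
  have h := MaximalGating.regular_stage c hc i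
  exact ⟨fun C C' hCC hC hC' => h.existsUnique_Icc hCC hC hC', fun hC => h.existsUnique_active hC,
    h.linkedUp.right_row, h.strictNonOverlapping,
    fun l hl D h1 h2 => (h.linkedUp.adj l hl D h1 h2).trans (Nat.lt_succ_self i)⟩
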